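/- Let $X$ be a set with at least two points. A quasi-metric on $X$ is a function $d:X\times X\to[0,\infty)$ such that $d(x,y)=0$ if and only if $x=y$, and for which there are constants $C_0,C_1\in(0,\infty)$ with $d(y,x)\le C_0\,d(x,y)$ and $d(x,y)\le C_1\max\{d(x,z),d(z,y)\}$ for all $x,y,z\in X$. Write $$C_d:=\sup\Big\{\tfrac{d(x,y)}{\max\{d(x,z),d(z,y)\}}:\ x,y,z\in X \text{ not all equal}\Big\}\in[1,\infty),\qquad B_d(x,r):=\{y\in X:\ d(x,y)<r\},$$ and let $\tau_d$ be the topology whose open sets are the sets $O\subseteq X$ such that every $x\in O$ has some $r>0$ with $B_d(x,r)\subseteq O$. Two quasi-metrics $d,\rho$ are equivalent, $\rho\approx d$, if $\kappa^{-1}\rho\le d\le\kappa\rho$ for some constant $\kappa>0$. Put $$\mathrm{ind}(X,d):=\sup_{\rho\approx d}(\log_2 C_\rho)^{-1}\in(0,\infty],\qquad 1/0:=\infty,$$ the supremum being over all quasi-metrics $\rho$ on $X$ equivalent to $d$. For $\alpha\in(0,\infty)$ and $q\in(0,\infty]$, write $\alpha\preceq_q\mathrm{ind}(X,d)$ if $\alpha\le\mathrm{ind}(X,d)$,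 where equality is permitted only if $q=\infty$ and the supremum defining $\mathrm{ind}(X,d)$ is attained. Let $(X,d,\mu)$ be a quasi-metric-measure space, that is, $d$ is a quasi-metric on $X$ and $\mu$ is a nonnegative measure on a $\sigma$-algebra that contains the Borel sets of $\tau_d$ and all the balls $B_d(x,r)$, with $0<\mu(B_d(x,r))<\infty$ for all $x\in X$ and $r\in(0,\infty)$. Let $\alpha,p\in(0,\infty)$ and $q\in(0,\infty]$. An $\alpha$-fractional gradient of a measurable $u:X\to\mathbb R$ is a sequence $\vec g=(g_k)_{k\in\mathbb Z}$ of nonnegative (possibly $+\infty$-valued) measurable functions on $X$ for which there is a measurable set $E$ with $\mu(E)=0$ and $$|u(x)-u(y)|\le d(x,y)^\alpha\,(g_k(x)+g_k(y))$$ for all $k\in\mathbb Z$ and $x,y\in X\setminus E$ with $2^{-k-1}\le d(x,y)<2^{-k}$. Let $\|u\|_{\dot M^\alpha_{p,q}}$ and $\|u\|_{\dot N^\alpha_{p,q}}$ be the infima over all $\alpha$-fractional gradients $\vec g$ of $u$ of $\big\|\,\|(g_k)_k\|_{\ell^q(\mathbb Z)}\big\|_{L^p(X,\mu)}$ and of $\big\|(\|g_k\|_{L^p(X,\mu)})_k\big\|_{\ell^q(\mathbb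 Z)}$, respectively. The spaces $M^\alpha_{p,q}(X,d,\mu)$ and $N^\alpha_{p,q}(X,d,\mu)$ consist of the measurable $u\in L^p(X,\mu)$ for which the respective semi-norm is finite, with the (quasi-)norm $\|u\|_{L^p(X,\mu)}$ plus that semi-norm. The embedding of such a space into $L^p(X,\mu)$ is compact if every sequence bounded in the space has a subsequence that converges in $L^p(X,\mu)$. Theorem. Suppose that there is $\delta_0\in(0,\infty)$ such that for every $\delta\in(0,\delta_0]$ the measure $\mu$ is $(C_d,\delta)$-doubling, i.e. there is a constant $C(\delta)\in[1,\infty)$ with $\mu(B_d(x,C_d\delta))\le C(\delta)\,\mu(B_d(x,\delta))$ for all $x\in X$. Then the following statements are equivalent. 1. $(X,d)$ is totally bounded, i.e. for every $\varepsilon>0$ it is covered by finitely many balls $B_d(x,\varepsilon)$. 2. $\mu$ is integrable, i.e. there is a quasi-metric $\rho\approx d$ such that for every $r\in(0,\infty)$ all the balls $B_\rho(x,r)$ are measurable, the function $x\mapsto\mu(B_\rho(x,r))$ is measurable, and $\int_X\frac{1}{\mu(B_\rho(x,r))}\,d\mu(x)<\infty$. 3. For all $\alpha,p\in(0,\infty)$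 and $q\in(0,\infty]$ with $\alpha\preceq_q\mathrm{ind}(X,d)$, the embedding $M^\alpha_{p,q}(X,d,\mu)\hookrightarrow L^p(X,\mu)$ is compact. 4. For all $\alpha,p\in(0,\infty)$ and $q\in(0,\infty]$ with $\alpha\preceq_q\mathrm{ind}(X,d)$, the embedding $N^\alpha_{p,q}(X,d,\mu)\hookrightarrow L^p(X,\mu)$ is compact. 5. There exist $\alpha,p\in(0,\infty)$ and $q\in(0,\infty]$ with $\alpha\preceq_q\mathrm{ind}(X,d)$ such that the embedding $M^\alpha_{p,q}(X,d,\mu)\hookrightarrow L^p(X,\mu)$ is compact. 6. There exist $\alpha,p\in(0,\infty)$ and $q\in(0,\infty]$ with $\alpha\preceq_q\mathrm{ind}(X,d)$ such that the embedding $N^\alpha_{p,q}(X,d,\mu)\hookrightarrow L^p(X,\mu)$ is compact. -/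

import Mathlib

open MeasureTheory Filter Topology
open scoped ENNReal

noncomputable section

namespace QuasiMetric

/-- `d` is a quasi-metric on `X`. -/
structure IsQuasiMetric {X : Type*} (d : X → X → ℝ) : Prop where
  nonneg : ∀ x y, 0 ≤ d x y
  eq_zero_iff : ∀ x y, d x y = 0 ↔ x = y
  quasi_symm : ∃ C₀ : ℝ, 0 < C₀ ∧ ∀ x y, d y x ≤ C₀ * d x y
  quasi_triangle : ∃ C₁ : ℝ, 0 < C₁ ∧ ∀ x y z, d x y ≤ C₁ * max (d x z) (d z y)

/-- The ball `B_d(x, r) = {y : d(x, y) < r}`; the order of the arguments of `d` matters. -/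
def qball {X : Type*} (d : X → X → ℝ) (x : X) (r : ℝ) : Set X := {y | d x y < r}

/-- The optimal constant `C_d` in the quasi-ultrametric inequality. For a quasi-metric on a set
with at least two points this is a supremum of a nonempty bounded set, and it is at least `1`. -/
def optConst {X : Type*} (d : X → X → ℝ) : ℝ :=
  sSup {t : ℝ | ∃ x y z : X, ¬ (x = y ∧ y = z) ∧ t = d x y / max (d x z) (d z y)}

/-- Equivalence `d ≈ ρ` of quasi-metrics. -/
def Equivalent {X : Type*} (d ρ : X → X → ℝ) : Prop :=
  ∃ κ : ℝ, 0 < κ ∧ ∀ x y, κ⁻¹ * ρ x y ≤ d x y ∧ d x y ≤ κ * ρ x y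

/-- The number `(log₂ C_ρ)⁻¹ ∈ (0, ∞]`, with the convention `1 / 0 = ∞`. -/
def smoothness {X : Type*} (ρ : X → X → ℝ) : ℝ≥0∞ :=
  (ENNReal.ofReal (Real.logb 2 (optConst ρ)))⁻¹

/-- The lower smoothness index `ind(X, d)`. -/
def ind {X : Type*} (d : X → X → ℝ) : ℝ≥0∞ :=
  ⨆ (ρ : X → X → ℝ) (_ : IsQuasiMetric ρ ∧ Equivalent d ρ), smoothness ρ

/-- The supremum defining `ind(X, d)` is attained. -/
def IndAttained {X : Type*} (d : X → X → ℝ) : Prop :=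
  ∃ ρ : X → X → ℝ, IsQuasiMetric ρ ∧ Equivalent d ρ ∧ smoothness ρ = ind d

/-- The relation `α ⪯_q ind(X, d)`: one has `α ≤ ind(X, d)`, and equality is permitted only if
`q = ∞` and the supremum defining `ind(X, d)` is attained. -/
def Admissible {X : Type*} (d : X → X → ℝ) (α : ℝ) (q : ℝ≥0∞) : Prop :=
  ENNReal.ofReal α ≤ ind d ∧ (ENNReal.ofReal α = ind d → q = ∞ ∧ IndAttained d)

/-- The topology `τ_d`: a set is open if it contains a ball around each of its points. -/
@[reducible] def qtopology {X : Type*} (d : X → X → ℝ) : TopologicalSpace X where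
  IsOpen O := ∀ x ∈ O, ∃ r : ℝ, 0 < r ∧ qball d x r ⊆ O
  isOpen_univ := fun _ _ => ⟨1, one_pos, Set.subset_univ _⟩
  isOpen_inter := by
    intro s t hs ht x hx
    obtain ⟨r, hr, hrs⟩ := hs x hx.1
    obtain ⟨r', hr', hrt⟩ := ht x hx.2
    refine ⟨min r r', lt_min hr hr', fun y hy => ⟨hrs ?_, hrt ?_⟩⟩
    · exact lt_of_lt_of_le (show d x y < min r r' from hy) (min_le_left _ _)
    · exact lt_of_lt_of_le (show d x y < min r r' from hy) (min_le_right _ _)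
  isOpen_sUnion := by
    intro S hS x hx
    obtain ⟨s, hsS, hxs⟩ := hx
    obtain ⟨r, hr, hrs⟩ := hS s hsS x hxs
    exact ⟨r, hr, fun y hy => ⟨s, hsS, hrs hy⟩⟩

/-- `(X, d, μ)` is a quasi-metric-measure space. The sigma-algebra on which `μ` is defined
contains the Borel sets of `τ_d` but may be larger. -/
structure IsQuasiMetricMeasureSpace {X : Type*} [mX : MeasurableSpace X]
    (d : X → X → ℝ) (μ : Measure X) : Prop where
  isQuasiMetric : IsQuasiMetric d
  borel_le : @borel X (qtopology d) ≤ mX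
  measurableSet_qball : ∀ (x : X) (r : ℝ), 0 < r → MeasurableSet (qball d x r)
  measure_qball_pos : ∀ (x : X) (r : ℝ), 0 < r → 0 < μ (qball d x r)
  measure_qball_lt_top : ∀ (x : X) (r : ℝ), 0 < r → μ (qball d x r) < ∞

/-- `μ` is `(c, δ)`-doubling with respect to `d`. -/
def IsDoublingAt {X : Type*} [MeasurableSpace X] (d : X → X → ℝ) (μ : Measure X)
    (c δ : ℝ) : Prop :=
  ∃ C : ℝ, 1 ≤ C ∧ ∀ x : X, μ (qball d x (c * δ)) ≤ ENNReal.ofReal C * μ (qball d x δ)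

/-- `(X, d)` is totally bounded: it is covered by finitely many balls of any given radius. -/
def IsTotallyBounded {X : Type*} (d : X → X → ℝ) : Prop :=
  ∀ ε : ℝ, 0 < ε → ∃ t : Finset X, (⋃ x ∈ t, qball d x ε) = Set.univ

/-- The measure `μ` is integrable: for some quasi-metric `ρ ≈ d` and every `r > 0`, the function
`x ↦ μ(B_ρ(x, r))` is well defined and measurable, and its reciprocal has finite integral. -/
def IsIntegrableMeasure {X : Type*} [MeasurableSpace X] (d : X → X → ℝ) (μ : Measure X) : Prop :=
  ∃ ρ : X → X → ℝ, IsQuasiMetric ρ ∧ Equivalent d ρ ∧ ∀ r : ℝ, 0 < r →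
    (∀ x, MeasurableSet (qball ρ x r)) ∧ Measurable (fun x => μ (qball ρ x r)) ∧
      ∫⁻ x, (μ (qball ρ x r))⁻¹ ∂μ < ∞

/-- `g = (g_k)_{k ∈ ℤ}` is an `α`-fractional gradient of `u`. Values in `[0, ∞]` are allowed. -/
def IsFracGradient {X : Type*} [MeasurableSpace X] (d : X → X → ℝ) (μ : Measure X) (α : ℝ)
    (u : X → ℝ) (g : ℤ → X → ℝ≥0∞) : Prop :=
  (∀ k, Measurable (g k)) ∧ ∃ E : Set X, MeasurableSet E ∧ μ E = 0 ∧
    ∀ (k : ℤ) (x y : X), x ∉ E → y ∉ E →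
      (2 : ℝ) ^ (-k - 1) ≤ d x y → d x y < (2 : ℝ) ^ (-k) →
        ENNReal.ofReal |u x - u y| ≤ ENNReal.ofReal (d x y ^ α) * (g k x + g k y)

/-- The `ℓ^q(ℤ)` (quasi-)norm of a sequence of elements of `[0, ∞]`, for `q ∈ (0, ∞]`. -/
def ellNorm (q : ℝ≥0∞) (a : ℤ → ℝ≥0∞) : ℝ≥0∞ :=
  if q = ∞ then ⨆ k, a k else (∑' k, a k ^ q.toReal) ^ (1 / q.toReal)

/-- The homogeneous Hajłasz–Triebel–Lizorkin semi-norm (`∞` if there is no gradient of finite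
mixed norm). -/
def homSeminormM {X : Type*} [MeasurableSpace X] (d : X → X → ℝ) (μ : Measure X) (α : ℝ)
    (p q : ℝ≥0∞) (u : X → ℝ) : ℝ≥0∞ :=
  ⨅ (g : ℤ → X → ℝ≥0∞) (_ : IsFracGradient d μ α u g),
    eLpNorm (fun x => ellNorm q (fun k => g k x)) p μ

/-- The homogeneous Hajłasz–Besov semi-norm (`∞` if there is no gradient of finite mixed norm). -/
def homSeminormN {X : Type*} [MeasurableSpace X] (d : X → X → ℝ) (μ : Measure X) (α : ℝ)
    (p q : ℝ≥0∞) (u : X → ℝ) : ℝ≥0∞ :=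
  ⨅ (g : ℤ → X → ℝ≥0∞) (_ : IsFracGradient d μ α u g),
    ellNorm q (fun k => eLpNorm (g k) p μ)

/-- The inhomogeneous Hajłasz–Triebel–Lizorkin space `M^α_{p,q}(X, d, μ)`. -/
def spaceM {X : Type*} [MeasurableSpace X] (d : X → X → ℝ) (μ : Measure X) (α : ℝ)
    (p q : ℝ≥0∞) : Set (X → ℝ) :=
  {u | Measurable u ∧ MemLp u p μ ∧ homSeminormM d μ α p q u < ∞}

/-- The (quasi-)norm of `M^α_{p,q}(X, d, μ)`. -/
def normM {X : Type*} [MeasurableSpace X] (d : X → X → ℝ) (μ : Measure X) (α : ℝ)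
    (p q : ℝ≥0∞) (u : X → ℝ) : ℝ≥0∞ :=
  eLpNorm u p μ + homSeminormM d μ α p q u

/-- The inhomogeneous Hajłasz–Besov space `N^α_{p,q}(X, d, μ)`. -/
def spaceN {X : Type*} [MeasurableSpace X] (d : X → X → ℝ) (μ : Measure X) (α : ℝ)
    (p q : ℝ≥0∞) : Set (X → ℝ) :=
  {u | Measurable u ∧ MemLp u p μ ∧ homSeminormN d μ α p q u < ∞}

/-- The (quasi-)norm of `N^α_{p,q}(X, d, μ)`. -/
def normN {X : Type*} [MeasurableSpace X] (d : X → X → ℝ) (μ : Measure X) (α : ℝ)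
    (p q : ℝ≥0∞) (u : X → ℝ) : ℝ≥0∞ :=
  eLpNorm u p μ + homSeminormN d μ α p q u

/-- A function space `S ⊆ L^p(X, μ)` with (quasi-)norm `N` embeds compactly into `L^p(X, μ)`:
`S` is contained in `L^p(X, μ)`, and every sequence that is bounded in `S` has a subsequence
that converges in `L^p(X, μ)`. -/
def EmbedsCompactly {X : Type*} [MeasurableSpace X] (S : Set (X → ℝ)) (N : (X → ℝ) → ℝ≥0∞)
    (p : ℝ≥0∞) (μ : Measure X) : Prop :=
  (∀ u ∈ S, MemLp u p μ) ∧
  ∀ u : ℕ → X → ℝ, (∀ n, u n ∈ S) → (∃ C : ℝ≥0∞, C < ∞ ∧ ∀ n, N (u n) ≤ C) →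
    ∃ (f : X → ℝ) (φ : ℕ → ℕ), MemLp f p μ ∧ StrictMono φ ∧
      Tendsto (fun n => eLpNorm (u (φ n) - f) p μ) atTop (𝓝 0)

/-- The embedding `M^α_{p,q}(X, d, μ) ↪ L^p(X, μ)` is compact. -/
def CompactEmbM {X : Type*} [MeasurableSpace X] (d : X → X → ℝ) (μ : Measure X) (α : ℝ)
    (p q : ℝ≥0∞) : Prop :=
  EmbedsCompactly (spaceM d μ α p q) (normM d μ α p q) p μ

/-- The embedding `N^α_{p,q}(X, d, μ) ↪ L^p(X, μ)` is compact. -/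
def CompactEmbN {X : Type*} [MeasurableSpace X] (d : X → X → ℝ) (μ : Measure X) (α : ℝ)
    (p q : ℝ≥0∞) : Prop :=
  EmbedsCompactly (spaceN d μ α p q) (normN d μ α p q) p μ

end QuasiMetric

end

/-! Every statement is compared with total boundedness.

If the space is totally bounded, `μ` is finite and balls of a fixed radius have measure bounded
below, so the integral in 2 is finite; the issue there is measurability. Frink's lemma
(`exists_metric_of_le_two_mul_max`) makes a small power `d ^ β` comparable to a metric `D`. Taking
`ρ = D ^ β⁻¹`, the balls are open for `τ_d` and `x ↦ μ(B_ρ(x, r))` is lower semicontinuous. For 3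
and 4, a bound on either norm yields gradients bounded in `ℓ^∞(L^p)`, hence oscillation at small
scales that is uniformly small in `L^p` (`exists_modulus`). A finite partition into small cells then
approximates the functions by step functions with bounded coefficients, and compactness of the
coefficient boxes gives a convergent subsequence (`exists_subseq_tendsto_of_step_approx`).

If the space is not totally bounded, a separated sequence has pairwise disjoint balls of a fixed
small radius. By doubling each contributes a fixed amount to the integral in 2, which therefore
diverges. Also by doubling, bumps on these balls normalised in `L^p` are bounded in the function
space yet mutually separated in `L^p` (`isTotallyBounded_of_embedsCompactly`). Admissibility of `α`
supplies bumps that are Hölder of an order `β ≥ α`, with `β > α` unless `q = ∞`; this makes their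
gradients `ℓ^q`-summable over the scales. -/

namespace QuasiMetric

/-! ### Quasi-metric constants and separated sequences -/

section Basic

variable {X : Type*} {d : X → X → ℝ}

theorem IsQuasiMetric.self (hd : IsQuasiMetric d) (x : X) : d x x = 0 :=
  (hd.eq_zero_iff x x).2 rfl

theorem IsQuasiMetric.pos (hd : IsQuasiMetric d) {x y : X} (h : x ≠ y) : 0 < d x y :=
  lt_of_le_of_ne (hd.nonneg x y) fun h0 => h ((hd.eq_zero_iff x y).1 h0.symm)

theorem IsQuasiMetric.max_pos (hd : IsQuasiMetric d) {x y z : X} (h : ¬ (x = y ∧ y = z)) :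
    0 < max (d x z) (d z y) := by
  by_contra hcon
  have h1 := max_le_iff.1 (not_lt.1 hcon)
  have hxz := (hd.eq_zero_iff x z).1 (le_antisymm h1.1 (hd.nonneg _ _))
  have hzy := (hd.eq_zero_iff z y).1 (le_antisymm h1.2 (hd.nonneg _ _))
  exact h ⟨hxz.trans hzy, hzy.symm⟩

theorem IsQuasiMetric.bddAbove_ratios (hd : IsQuasiMetric d) :
    BddAbove {t : ℝ | ∃ x y z : X, ¬ (x = y ∧ y = z) ∧ t = d x y / max (d x z) (d z y)} := by
  obtain ⟨C, -, hC⟩ := hd.quasi_triangle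
  refine ⟨C, ?_⟩
  rintro t ⟨x, y, z, hne, rfl⟩
  exact (div_le_iff₀ (hd.max_pos hne)).2 (hC x y z)

theorem IsQuasiMetric.le_optConst_mul (hd : IsQuasiMetric d) (x y z : X) :
    d x y ≤ optConst d * max (d x z) (d z y) := by
  by_cases h : x = y ∧ y = z
  · obtain ⟨rfl, rfl⟩ := h
    simp [hd.self]
  · exact (div_le_iff₀ (hd.max_pos h)).1 (le_csSup hd.bddAbove_ratios ⟨x, y, z, h, rfl⟩)

theorem IsQuasiMetric.one_le_optConst [Nontrivial X] (hd : IsQuasiMetric d) :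
    1 ≤ optConst d := by
  obtain ⟨x, y, hxy⟩ := exists_pair_ne X
  refine le_csSup hd.bddAbove_ratios ⟨x, y, y, fun h => hxy h.1, ?_⟩
  rw [hd.self, max_eq_left (hd.nonneg x y), div_self (hd.pos hxy).ne']

theorem IsQuasiMetric.exists_symm_const (hd : IsQuasiMetric d) :
    ∃ C : ℝ, 1 ≤ C ∧ ∀ x y, d y x ≤ C * d x y := by
  obtain ⟨C, -, h⟩ := hd.quasi_symm
  exact ⟨max C 1, le_max_right _ _, fun x y =>
    (h x y).trans (mul_le_mul_of_nonneg_right (le_max_left _ _) (hd.nonneg x y))⟩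

theorem mem_qball {x y : X} {r : ℝ} : y ∈ qball d x r ↔ d x y < r := Iff.rfl

theorem qball_mono (x : X) {r s : ℝ} (h : r ≤ s) : qball d x r ⊆ qball d x s :=
  fun _ hy => lt_of_lt_of_le hy h

theorem Equivalent.exists_one_le {ρ : X → X → ℝ} (hd : IsQuasiMetric d) (hρ : IsQuasiMetric ρ)
    (h : Equivalent d ρ) :
    ∃ κ : ℝ, 1 ≤ κ ∧ ∀ x y, ρ x y ≤ κ * d x y ∧ d x y ≤ κ * ρ x y := by
  obtain ⟨κ, hκ, h⟩ := h
  refine ⟨max κ 1, le_max_right _ _, fun x y => ⟨?_, ?_⟩⟩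
  · have h1 := (inv_mul_le_iff₀ hκ).1 (h x y).1
    exact h1.trans (mul_le_mul_of_nonneg_right (le_max_left _ _) (hd.nonneg x y))
  · exact (h x y).2.trans (mul_le_mul_of_nonneg_right (le_max_left _ _) (hρ.nonneg x y))

/-- Greedy choice: finitely many `ε`-balls never cover, so a further point outside them exists. As
`d` need not be symmetric, separation is obtained in one order of the indices only. -/
theorem exists_separated_seq_of_not_isTotallyBounded (h : ¬ IsTotallyBounded d) :
    ∃ ε : ℝ, 0 < ε ∧ ∃ x : ℕ → X, ∀ m n, m < n → ε ≤ d (x m) (x n) := by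
  unfold IsTotallyBounded at h
  push Not at h
  obtain ⟨ε, hε, h⟩ := h
  refine ⟨ε, hε, ?_⟩
  obtain ⟨f, -, hf⟩ := exists_seq_of_forall_finset_exists (fun _ : X => True)
    (fun x y => ε ≤ d x y) (fun s _ => by
      obtain ⟨y, hy⟩ := (Set.ne_univ_iff_exists_notMem _).1 (h s)
      simp only [Set.mem_iUnion, not_exists, mem_qball, not_lt] at hy
      exact ⟨y, trivial, fun x hx => hy x hx⟩)
  exact ⟨f, hf⟩

/-- Sufficiently small balls around the points of a separated sequence are disjoint. -/
theorem IsQuasiMetric.exists_disjoint_balls [Nontrivial X] (hd : IsQuasiMetric d) {ε : ℝ}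
    (hε : 0 < ε) {x : ℕ → X} (hx : ∀ m n, m < n → ε ≤ d (x m) (x n)) :
    ∃ R₀ : ℝ, 0 < R₀ ∧ ∀ R ≤ R₀, Pairwise fun m n =>
      Disjoint (qball d (x m) R) (qball d (x n) R) := by
  obtain ⟨C, hC, hsymm⟩ := hd.exists_symm_const
  have hK := hd.one_le_optConst
  have hK0 : 0 < optConst d := by linarith
  have hC0 : 0 < C := by linarith
  -- A common point `z` of two balls satisfies `d (x m) z < C * R` and, after reversing the
  -- arguments, `d z (x n) < C * R`; the quasi-triangle inequality then contradicts separation.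
  refine ⟨ε / (optConst d * C), by positivity, fun R hR => ?_⟩
  have key : ∀ m n, m < n → Disjoint (qball d (x m) R) (qball d (x n) R) := by
    intro m n hmn
    rw [Set.disjoint_left]
    intro z hzm hzn
    rw [mem_qball] at hzm hzn
    have h1 : d z (x n) < C * R :=
      (hsymm (x n) z).trans_lt (mul_lt_mul_of_pos_left hzn hC0)
    have hR0 : 0 < R := (hd.nonneg _ _).trans_lt hzm
    have h2 : d (x m) z < C * R := by nlinarith
    have h3 := hd.le_optConst_mul (x m) (x n) z
    have h4 : optConst d * max (d (x m) z) (d z (x n)) < optConst d * (C * R) :=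
      mul_lt_mul_of_pos_left (max_lt h2 h1) hK0
    have h5 : optConst d * (C * R) ≤ ε := by
      rw [le_div_iff₀ (by positivity)] at hR
      linarith
    linarith [hx m n hmn]
  intro m n hmn
  rcases lt_or_gt_of_ne hmn with h | h
  · exact key m n h
  · exact (key n m h).symm

end Basic

/-! ### Frink metrization of powers of a quasi-metric -/

section Metrization

variable {X : Type*}

/-- Frink's chain lemma: a function satisfying `f a b ≤ 2 max (f a c) (f c b)` is controlled along
every chain by the sum over the links of the chain, with constant `4` for inner links and `2` for
the two outer ones. -/
theorem frink_chain_aux {f : X → X → ℝ} (hnn : ∀ a b, 0 ≤ f a b)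
    (hf : ∀ a b c, f a b ≤ 2 * max (f a c) (f c b)) (s : ℕ → X) (n : ℕ) :
    ∀ i, f (s i) (s (i + n + 2)) ≤
      4 * (∑ m ∈ Finset.Ico i (i + n + 2), f (s m) (s (m + 1))) -
        2 * f (s i) (s (i + 1)) - 2 * f (s (i + n + 1)) (s (i + n + 2)) := by
  induction n using Nat.strong_induction_on with
  | _ n ih =>
    intro i
    set e : ℕ → ℝ := fun m => f (s m) (s (m + 1)) with he
    have henn : ∀ m, 0 ≤ e m := fun m => hnn _ _
    have hfirst : 2 * e i + 2 * e (i + n + 1) ≤ 4 * (∑ m ∈ Finset.Ico i (i + n + 2), e m)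
        - 2 * e i - 2 * e (i + n + 1) := by
      rw [Finset.sum_eq_sum_Ico_succ_bot (by omega), Finset.sum_Ico_succ_top (by omega)]
      have : 0 ≤ ∑ m ∈ Finset.Ico (i + 1) (i + n + 1), e m := Finset.sum_nonneg fun m _ => henn m
      linarith
    have hP : ∃ k ≤ n + 1, f (s i) (s (i + n + 2)) ≤ 2 * f (s (i + k)) (s (i + n + 2)) :=
      ⟨0, by omega, by have := hnn (s i) (s (i + n + 2)); simpa using by linarith⟩
    classical
    -- `k` is the last index from which the tail still carries half of `f (s i) (s (i + n + 2))`.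
    -- Since `k + 1` fails, the head up to `k + 1` carries half as well.
    set P : ℕ → Prop := fun k => f (s i) (s (i + n + 2)) ≤ 2 * f (s (i + k)) (s (i + n + 2))
    obtain ⟨k₀, hk₀, hPk₀⟩ := hP
    set k := Nat.findGreatest P (n + 1)
    have hPk : P k := Nat.findGreatest_spec (P := P) hk₀ hPk₀
    have hkn : k ≤ n + 1 := Nat.findGreatest_le _
    show f (s i) (s (i + n + 2)) ≤ 4 * (∑ m ∈ Finset.Ico i (i + n + 2), e m)
        - 2 * e i - 2 * e (i + n + 1)
    rcases Nat.eq_or_lt_of_le hkn with hkn | hkn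
    · have h1 : f (s i) (s (i + n + 2)) ≤ 2 * e (i + n + 1) := by
        have := hPk
        simp only [P, hkn] at this
        exact this
      linarith [henn i]
    · have hnot : ¬ P (k + 1) := Nat.findGreatest_is_greatest (P := P) (Nat.lt_succ_self k) (by omega)
      have h2 : f (s i) (s (i + n + 2)) ≤ 2 * f (s i) (s (i + (k + 1))) := by
        have h3 := hf (s i) (s (i + n + 2)) (s (i + (k + 1)))
        rw [mul_max_of_nonneg _ _ (by norm_num)] at h3
        rcases le_max_iff.1 h3 with h | h
        · exact h
        · exact absurd h hnot
      rcases Nat.eq_zero_or_pos k with h0 | h0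
      · rw [h0] at h2
        have h4 : f (s i) (s (i + n + 2)) ≤ 2 * e i := h2
        linarith [henn (i + n + 1)]
      · clear_value k
        obtain ⟨j, rfl⟩ : ∃ j, k = j + 1 := ⟨k - 1, by omega⟩
        have hA := ih j (by omega) i
        have hB := ih (n - (j + 1)) (by omega) (i + (j + 1))
        rw [show i + (j + 1) + (n - (j + 1)) + 2 = i + n + 2 by omega,
          show i + (j + 1) + (n - (j + 1)) + 1 = i + n + 1 by omega] at hB
        -- Head and tail overlap in the link at `i + (j + 1)`. Its extra weight `4` is cancelled by
        -- the savings of `2` on an outer link in each of `hA` and `hB`.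
        have hsum : ∑ m ∈ Finset.Ico i (i + n + 2), e m + e (i + (j + 1)) =
            ∑ m ∈ Finset.Ico i (i + j + 2), e m +
              ∑ m ∈ Finset.Ico (i + (j + 1)) (i + n + 2), e m := by
          rw [← Finset.sum_Ico_consecutive e (show i ≤ i + j + 2 by omega)
            (show i + j + 2 ≤ i + n + 2 by omega),
            Finset.sum_eq_sum_Ico_succ_bot (show i + (j + 1) < i + n + 2 by omega)]
          rw [show i + (j + 1) + 1 = i + j + 2 by omega]
          ring
        have hPk' : f (s i) (s (i + n + 2)) ≤ 2 * f (s (i + (j + 1))) (s (i + n + 2)) := hPk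
        change f (s i) (s (i + j + 2)) ≤ 4 * (∑ m ∈ Finset.Ico i (i + j + 2), e m) - 2 * e i -
          2 * e (i + (j + 1)) at hA
        change _ ≤ 4 * (∑ m ∈ Finset.Ico (i + (j + 1)) (i + n + 2), e m) - 2 * e (i + (j + 1)) -
          2 * e (i + n + 1) at hB
        change f (s i) (s (i + n + 2)) ≤ 2 * f (s i) (s (i + j + 2)) at h2
        linarith

theorem frink_chain {f : X → X → ℝ} (hnn : ∀ a b, 0 ≤ f a b)
    (hf : ∀ a b c, f a b ≤ 2 * max (f a c) (f c b)) (s : ℕ → X) (n : ℕ) :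
    f (s 0) (s (n + 1)) ≤ 4 * ∑ m ∈ Finset.range (n + 1), f (s m) (s (m + 1)) := by
  rcases n with _ | n
  · have := hnn (s 0) (s 1)
    simpa using by linarith
  · have h := frink_chain_aux hnn hf s n 0
    simp only [zero_add, ← Finset.range_eq_Ico] at h
    linarith [hnn (s 0) (s 1), hnn (s (n + 1)) (s (n + 2))]

/-- Translates the list-indexed chains in the definition of `PseudoMetricSpace.ofPreNNDist` into the
sequence-indexed chains of `frink_chain`. -/
theorem sum_zipWith_chain {M : Type*} [AddCommMonoid M] (f : X → X → M) (l : List X) (x y : X) :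
    ∃ s : ℕ → X, s 0 = x ∧ s (l.length + 1) = y ∧
      (List.zipWith f (x :: l) (l ++ [y])).sum =
        ∑ m ∈ Finset.range (l.length + 1), f (s m) (s (m + 1)) := by
  induction l generalizing x with
  | nil => exact ⟨fun n => if n = 0 then x else y, by simp, by simp, by simp⟩
  | cons a l ih =>
    obtain ⟨s, h0, h1, h2⟩ := ih a
    refine ⟨fun n => Nat.casesOn n x s, rfl, h1, ?_⟩
    rw [List.length_cons, Finset.sum_range_succ', List.cons_append, List.zipWith_cons_cons,
      List.sum_cons, h2, add_comm]
    simp [h0]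

/-- Frink's metrization lemma. -/
theorem exists_metric_of_le_two_mul_max {f : X → X → ℝ} (hnn : ∀ a b, 0 ≤ f a b)
    (hself : ∀ a, f a a = 0) (hsymm : ∀ a b, f a b = f b a)
    (hf : ∀ a b c, f a b ≤ 2 * max (f a c) (f c b)) :
    ∃ D : X → X → ℝ, (∀ x, D x x = 0) ∧ (∀ x y, D x y = D y x) ∧
      (∀ x y z, D x z ≤ D x y + D y z) ∧ ∀ x y, D x y ≤ f x y ∧ f x y ≤ 4 * D x y := by
  have h0 : ∀ x, (f x x).toNNReal = 0 := fun x => by simp [hself]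
  have hs : ∀ x y, (f x y).toNNReal = (f y x).toNNReal := fun x y => by rw [hsymm]
  -- The metric is the infimum of chain sums; the upper bound by `f` is the one-link chain, the
  -- lower bound is `frink_chain`.
  let _ := PseudoMetricSpace.ofPreNNDist (fun x y => (f x y).toNNReal) h0 hs
  refine ⟨dist, dist_self, dist_comm, dist_triangle, fun x y => ⟨?_, ?_⟩⟩
  · have := PseudoMetricSpace.dist_ofPreNNDist_le (fun x y => (f x y).toNNReal) h0 hs x y
    rwa [Real.coe_toNNReal _ (hnn x y)] at this
  · rw [PseudoMetricSpace.dist_ofPreNNDist (fun x y => (f x y).toNNReal) h0 hs]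
    rw [← Real.coe_toNNReal _ (hnn x y), ← NNReal.coe_ofNat 4, ← NNReal.coe_mul, NNReal.mul_iInf,
      NNReal.coe_le_coe]
    refine le_ciInf fun l => ?_
    obtain ⟨s, hs0, hs1, hsum⟩ := sum_zipWith_chain (fun x y => (f x y).toNNReal) l x y
    have h := frink_chain hnn hf s l.length
    rw [hs0, hs1] at h
    rw [hsum, ← NNReal.coe_le_coe]
    push_cast
    rw [Real.coe_toNNReal _ (hnn x y)]
    simpa only [Real.coe_toNNReal _ (hnn _ _)] using h

/-- If `C_ρ ^ β ≤ 2`, then `d ^ β` is equivalent to a metric for every `d ≈ ρ`. -/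
theorem IsQuasiMetric.exists_metric_rpow [Nontrivial X] {d ρ : X → X → ℝ} (hd : IsQuasiMetric d)
    (hρ : IsQuasiMetric ρ) (hdρ : Equivalent d ρ) {β : ℝ} (hβ : 0 < β)
    (hC : optConst ρ ^ β ≤ 2) :
    ∃ (D : X → X → ℝ) (K : ℝ), 0 < K ∧ (∀ x, D x x = 0) ∧ (∀ x y, D x y = D y x) ∧
      (∀ x y z, D x z ≤ D x y + D y z) ∧ ∀ x y, D x y ≤ K * d x y ^ β ∧ d x y ^ β ≤ K * D x y := by
  obtain ⟨κ, hκ, hκd⟩ := hdρ.exists_one_le hd hρ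
  obtain ⟨C, hC1, hCs⟩ := hρ.exists_symm_const
  have hκ0 : 0 < κ := by linarith
  have hC0 : 0 < C := by linarith
  -- Symmetrising by a maximum does not increase the quasi-triangle constant, so `σ ^ β` satisfies
  -- Frink's hypothesis with constant `2`.
  set σ : X → X → ℝ := fun x y => max (ρ x y) (ρ y x) with hσ
  have hσnn : ∀ x y, 0 ≤ σ x y := fun x y => (hρ.nonneg x y).trans (le_max_left _ _)
  have hopt : 0 ≤ optConst ρ := by linarith [hρ.one_le_optConst]
  have hσtri : ∀ x y z, σ x y ≤ optConst ρ * max (σ x z) (σ z y) := by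
    intro x y z
    refine max_le ((hρ.le_optConst_mul x y z).trans ?_) ((hρ.le_optConst_mul y x z).trans ?_)
    · exact mul_le_mul_of_nonneg_left (max_le_max (le_max_left _ _) (le_max_left _ _)) hopt
    · refine mul_le_mul_of_nonneg_left ?_ hopt
      rw [max_comm]
      exact max_le_max (le_max_right _ _) (le_max_right _ _)
  obtain ⟨D, h0, hs, ht, hD⟩ := exists_metric_of_le_two_mul_max (f := fun x y => σ x y ^ β)
    (fun a b => Real.rpow_nonneg (hσnn a b) _)
    (fun a => by simp [hσ, hρ.self, Real.zero_rpow hβ.ne'])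
    (fun a b => by simp only [hσ, max_comm])
    (fun a b c => by
      have h1 := Real.rpow_le_rpow (hσnn a b) (hσtri a b c) hβ.le
      rw [Real.mul_rpow hopt (le_max_of_le_left (hσnn a c)),
        (Real.monotoneOn_rpow_Ici_of_exponent_nonneg hβ.le).map_max (hσnn a c) (hσnn c b)] at h1
      refine h1.trans (mul_le_mul_of_nonneg_right hC ?_)
      exact le_max_of_le_left (Real.rpow_nonneg (hσnn a c) _))
  have hDnn : ∀ x y, 0 ≤ D x y := fun x y => by
    have := ht x y x
    rw [h0, hs y x] at this
    linarith
  refine ⟨D, max ((C * κ) ^ β) (κ ^ β * 4), by positivity, h0, hs, ht, fun x y => ⟨?_, ?_⟩⟩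
  · have h1 : σ x y ≤ C * κ * d x y := by
      have h2 : ρ x y ≤ C * ρ x y := by nlinarith [hρ.nonneg x y]
      refine (max_le h2 (hCs x y)).trans ?_
      rw [mul_assoc]
      exact mul_le_mul_of_nonneg_left (hκd x y).1 hC0.le
    refine (hD x y).1.trans ((Real.rpow_le_rpow (hσnn x y) h1 hβ.le).trans ?_)
    rw [Real.mul_rpow (by positivity) (hd.nonneg x y)]
    exact mul_le_mul_of_nonneg_right (le_max_left _ _) (Real.rpow_nonneg (hd.nonneg x y) _)
  · have h1 : d x y ≤ κ * σ x y :=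
      (hκd x y).2.trans (mul_le_mul_of_nonneg_left (le_max_left _ _) hκ0.le)
    refine (Real.rpow_le_rpow (hd.nonneg x y) h1 hβ.le).trans ?_
    rw [Real.mul_rpow hκ0.le (hσnn x y)]
    refine (mul_le_mul_of_nonneg_left (hD x y).2 (by positivity)).trans ?_
    rw [← mul_assoc]
    exact mul_le_mul_of_nonneg_right (le_max_right _ _) (hDnn x y)

/-- This makes sets open for `D` open for `τ_d`, and hence measurable. -/
theorem exists_qball_subset_of_le_rpow {d : X → X → ℝ} (hd : IsQuasiMetric d) {D : X → X → ℝ} {K β : ℝ}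
    (hK : 0 < K) (hβ : 0 < β) (hD : ∀ x y, D x y ≤ K * d x y ^ β) {r : ℝ} (hr : 0 < r) (x : X) :
    qball d x ((r / K) ^ β⁻¹) ⊆ qball D x r := fun y hy => by
  refine (hD x y).trans_lt ?_
  have h1 := Real.rpow_lt_rpow (hd.nonneg x y) hy hβ
  rw [Real.rpow_inv_rpow (by positivity) hβ.ne', lt_div_iff₀ hK] at h1
  linarith

theorem Equivalent.refl (d : X → X → ℝ) : Equivalent d d :=
  ⟨1, one_pos, fun x y => by simp⟩

theorem exists_rpow_le_two {C : ℝ} (hC : 1 ≤ C) : ∃ β : ℝ, 0 < β ∧ C ^ β ≤ 2 := by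
  rcases hC.eq_or_lt with rfl | hC
  · exact ⟨1, one_pos, by norm_num⟩
  · have h := Real.logb_pos one_lt_two hC
    refine ⟨(Real.logb 2 C)⁻¹, inv_pos.2 h, le_of_eq ?_⟩
    rw [Real.inv_logb, Real.rpow_logb (by linarith) hC.ne' two_pos]

end Metrization

/-! ### Total boundedness and integrability of the measure -/

section Integrable

variable {X : Type*} [MeasurableSpace X] {d : X → X → ℝ} {μ : Measure X}

/-- For `y` in one of the disjoint balls `B_d(x n, s)`, the ball `B_ρ(y, s / κ)` lies in `B_d(x n,
C_d s)`. A single doubling step bounds the integrand below by `1 / (C μ(B_d(x n, s)))`, so each ball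
contributes at least `1 / C`. -/
theorem isTotallyBounded_of_isIntegrableMeasure [Nontrivial X]
    (hX : IsQuasiMetricMeasureSpace d μ)
    (hdoub : ∃ δ₀ : ℝ, 0 < δ₀ ∧ ∀ δ : ℝ, 0 < δ → δ ≤ δ₀ → IsDoublingAt d μ (optConst d) δ)
    (h : IsIntegrableMeasure d μ) : IsTotallyBounded d := by
  have hd := hX.isQuasiMetric
  by_contra hnot
  obtain ⟨ε, hε, x, hx⟩ := exists_separated_seq_of_not_isTotallyBounded hnot
  obtain ⟨R₀, hR₀, hdisj⟩ := hd.exists_disjoint_balls hε hx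
  obtain ⟨δ₀, hδ₀, hdoub⟩ := hdoub
  set s := min R₀ δ₀
  have hs : 0 < s := lt_min hR₀ hδ₀
  obtain ⟨C, hC1, hC⟩ := hdoub s hs (min_le_right _ _)
  obtain ⟨ρ, hρ, hdρ, hint⟩ := h
  obtain ⟨κ, hκ1, hκ⟩ := hdρ.exists_one_le hd hρ
  have hκ0 : 0 < κ := by linarith
  have hK := hd.one_le_optConst
  obtain ⟨-, -, hfin⟩ := hint (s / κ) (by positivity)
  refine hfin.not_ge ?_
  have hsub : ∀ n, ∀ y ∈ qball d (x n) s,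
      (ENNReal.ofReal C * μ (qball d (x n) s))⁻¹ ≤ (μ (qball ρ y (s / κ)))⁻¹ := by
    intro n y hy
    refine ENNReal.inv_le_inv.2 (le_trans (measure_mono fun z hz => ?_) (hC (x n)))
    have h1 : d y z < s := by
      refine (hκ y z).2.trans_lt ?_
      rw [mem_qball, lt_div_iff₀ hκ0] at hz
      linarith
    exact (hd.le_optConst_mul _ _ y).trans_lt
      (mul_lt_mul_of_pos_left (max_lt hy h1) (by linarith))
  calc (∞ : ℝ≥0∞) = ∑' _ : ℕ, (ENNReal.ofReal C)⁻¹ :=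
        (ENNReal.tsum_const_eq_top_of_ne_zero (by simp)).symm
    _ ≤ ∑' n, ∫⁻ y in qball d (x n) s, (μ (qball ρ y (s / κ)))⁻¹ ∂μ := by
        refine ENNReal.tsum_le_tsum fun n => ?_
        have hpos := hX.measure_qball_pos (x n) s hs
        have hlt := hX.measure_qball_lt_top (x n) s hs
        calc (ENNReal.ofReal C)⁻¹
            = (ENNReal.ofReal C * μ (qball d (x n) s))⁻¹ * μ (qball d (x n) s) := by
              rw [ENNReal.mul_inv (Or.inr hlt.ne) (Or.inr hpos.ne'), mul_assoc,
                ENNReal.inv_mul_cancel hpos.ne' hlt.ne, mul_one]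
          _ ≤ _ := by
              rw [← setLIntegral_const]
              exact setLIntegral_mono' (hX.measurableSet_qball _ _ hs) (hsub n)
    _ = ∫⁻ y in ⋃ n, qball d (x n) s, (μ (qball ρ y (s / κ)))⁻¹ ∂μ :=
        (lintegral_iUnion (fun n => hX.measurableSet_qball _ _ hs)
          (hdisj s (min_le_left _ _)) _).symm
    _ ≤ _ := setLIntegral_le_lintegral _ _

theorem IsQuasiMetricMeasureSpace.measure_univ_lt_top (hX : IsQuasiMetricMeasureSpace d μ)
    (h : IsTotallyBounded d) : μ Set.univ < ∞ := by
  obtain ⟨t, ht⟩ := h 1 one_pos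
  rw [← ht]
  exact (measure_biUnion_finset_le _ _).trans_lt
    (ENNReal.sum_lt_top.2 fun x _ => hX.measure_qball_lt_top x 1 one_pos)

/-- Every ball of radius `r` contains one of the finitely many balls of a cover at a smaller radius
`ε`; the least of their measures serves. -/
theorem IsQuasiMetricMeasureSpace.exists_le_measure_qball [Nontrivial X]
    (hX : IsQuasiMetricMeasureSpace d μ) (h : IsTotallyBounded d) {r : ℝ} (hr : 0 < r) :
    ∃ c : ℝ≥0∞, 0 < c ∧ ∀ x, c ≤ μ (qball d x r) := by
  have hd := hX.isQuasiMetric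
  obtain ⟨C, hC1, hC⟩ := hd.exists_symm_const
  have hK := hd.one_le_optConst
  have hK0 : 0 < optConst d := by linarith
  have hC0 : 0 < C := by linarith
  set ε := r / (optConst d * C)
  have hε : 0 < ε := by positivity
  have hεr : optConst d * (C * ε) = r := by simp only [ε]; field_simp
  obtain ⟨t, ht⟩ := h ε hε
  have hcov : ∀ y, ∃ x ∈ t, y ∈ qball d x ε := fun y => by
    have : y ∈ ⋃ x ∈ t, qball d x ε := ht ▸ Set.mem_univ y
    simpa using this
  have hne : t.Nonempty := by
    obtain ⟨x, hx, -⟩ := hcov (Classical.arbitrary X)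
    exact ⟨x, hx⟩
  obtain ⟨x₀, -, hmin⟩ := t.exists_min_image (fun x => μ (qball d x ε)) hne
  refine ⟨μ (qball d x₀ ε), hX.measure_qball_pos _ _ hε, fun y => ?_⟩
  obtain ⟨x, hxt, hxy⟩ := hcov y
  refine (hmin x hxt).trans (measure_mono fun z hz => ?_)
  rw [mem_qball] at *
  have h1 : d y x < C * ε := (hC x y).trans_lt (mul_lt_mul_of_pos_left hxy hC0)
  have h2 : d x z < C * ε := by nlinarith
  rw [← hεr]
  exact (hd.le_optConst_mul y z x).trans_lt (mul_lt_mul_of_pos_left (max_lt h1 h2) hK0)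

theorem IsQuasiMetricMeasureSpace.measurableSet_of_isOpen (hX : IsQuasiMetricMeasureSpace d μ)
    {O : Set X} (hO : ∀ x ∈ O, ∃ r : ℝ, 0 < r ∧ qball d x r ⊆ O) : MeasurableSet O :=
  hX.borel_le O (MeasurableSpace.measurableSet_generateFrom hO)

theorem IsQuasiMetricMeasureSpace.measurableSet_of_isOpen_metric
    (hX : IsQuasiMetricMeasureSpace d μ) {D : X → X → ℝ} {K β : ℝ}
    (hK : 0 < K) (hβ : 0 < β) (hD : ∀ x y, D x y ≤ K * d x y ^ β) {O : Set X}
    (hO : ∀ x ∈ O, ∃ r : ℝ, 0 < r ∧ qball D x r ⊆ O) : MeasurableSet O := by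
  refine hX.measurableSet_of_isOpen fun x hx => ?_
  obtain ⟨r, hr, hrO⟩ := hO x hx
  exact ⟨(r / K) ^ β⁻¹, by positivity,
    (exists_qball_subset_of_le_rpow hX.isQuasiMetric hK hβ hD hr x).trans hrO⟩

theorem IsQuasiMetricMeasureSpace.measurableSet_qball_metric
    (hX : IsQuasiMetricMeasureSpace d μ) {D : X → X → ℝ} {K β : ℝ}
    (hK : 0 < K) (hβ : 0 < β) (hD : ∀ x y, D x y ≤ K * d x y ^ β)
    (htri : ∀ x y z, D x z ≤ D x y + D y z) (x : X) (r : ℝ) : MeasurableSet (qball D x r) := by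
  refine hX.measurableSet_of_isOpen_metric hK hβ hD fun y hy =>
    ⟨r - D x y, sub_pos.2 hy, fun z hz => ?_⟩
  rw [mem_qball] at *
  linarith [htri x y z]

/-- Lower semicontinuity: `μ(B_D(x, r))` is the supremum over slightly smaller radii, and `B_D(y,
r)` contains such a smaller ball about `x` once `y` is close to `x`. -/
theorem IsQuasiMetricMeasureSpace.measurable_measure_qball_metric
    (hX : IsQuasiMetricMeasureSpace d μ) {D : X → X → ℝ} {K β : ℝ}
    (hK : 0 < K) (hβ : 0 < β) (hD : ∀ x y, D x y ≤ K * d x y ^ β)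
    (hsymm : ∀ x y, D x y = D y x)
    (htri : ∀ x y z, D x z ≤ D x y + D y z) (r : ℝ) : Measurable fun x => μ (qball D x r) := by
  refine measurable_of_Ioi fun t => hX.measurableSet_of_isOpen_metric hK hβ hD fun x hx => ?_
  have hU : qball D x r = ⋃ n : ℕ, qball D x (r - 1 / ((n : ℝ) + 1)) := by
    ext y
    simp only [Set.mem_iUnion, mem_qball]
    refine ⟨fun hy => ?_, fun ⟨n, hn⟩ => ?_⟩
    · obtain ⟨n, hn⟩ := exists_nat_one_div_lt (sub_pos.2 hy)
      exact ⟨n, by linarith⟩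
    · have : (0 : ℝ) < 1 / ((n : ℝ) + 1) := by positivity
      linarith
  have hmono : Monotone fun n : ℕ => qball D x (r - 1 / ((n : ℝ) + 1)) := fun m n hmn =>
    qball_mono x (sub_le_sub_left (Nat.one_div_le_one_div hmn) r)
  rw [Set.mem_preimage, hU, hmono.measure_iUnion, Set.mem_Ioi, lt_iSup_iff] at hx
  obtain ⟨n, hn⟩ := hx
  refine ⟨1 / ((n : ℝ) + 1), by positivity, fun y hy => ?_⟩
  refine lt_of_lt_of_le hn (measure_mono fun z hz => ?_)
  rw [mem_qball] at *
  linarith [htri y x z, hsymm x y]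

theorem isIntegrableMeasure_of_isTotallyBounded [Nontrivial X]
    (hX : IsQuasiMetricMeasureSpace d μ) (h : IsTotallyBounded d) : IsIntegrableMeasure d μ := by
  have hd := hX.isQuasiMetric
  obtain ⟨β, hβ, hβC⟩ := exists_rpow_le_two hd.one_le_optConst
  obtain ⟨D, K, hK, h0, hsymm, htri, hD⟩ :=
    hd.exists_metric_rpow hd (Equivalent.refl d) hβ hβC
  have hDnn : ∀ x y, 0 ≤ D x y := fun x y => by
    have := htri x y x
    rw [h0, hsymm y x] at this
    linarith
  have hdnn : ∀ x y, 0 ≤ d x y := hd.nonneg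
  have hball : ∀ x, ∀ r : ℝ, 0 < r → qball (fun x y => D x y ^ β⁻¹) x r = qball D x (r ^ β) := by
    intro x r hr
    ext y
    rw [mem_qball, mem_qball, Real.rpow_inv_lt_iff_of_pos (hDnn x y) hr.le hβ]
  have hupper : ∀ x y, D x y ^ β⁻¹ ≤ K ^ β⁻¹ * d x y := fun x y => by
    have h1 := Real.rpow_le_rpow (hDnn x y) (hD x y).1 (inv_nonneg.2 hβ.le)
    rwa [Real.mul_rpow hK.le (Real.rpow_nonneg (hdnn x y) _),
      Real.rpow_rpow_inv (hdnn x y) hβ.ne'] at h1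
  have hlower : ∀ x y, d x y ≤ K ^ β⁻¹ * D x y ^ β⁻¹ := fun x y => by
    have h1 := Real.rpow_le_rpow (Real.rpow_nonneg (hdnn x y) _) (hD x y).2 (inv_nonneg.2 hβ.le)
    rwa [Real.mul_rpow hK.le (hDnn x y), Real.rpow_rpow_inv (hdnn x y) hβ.ne'] at h1
  have hKβ : 0 < K ^ β⁻¹ := by positivity
  -- Taking the root returns to the scale of `d`, and by `hball` the balls are still balls of the
  -- metric `D`.
  refine ⟨fun x y => D x y ^ β⁻¹, ⟨fun x y => Real.rpow_nonneg (hDnn x y) _, fun x y => ?_,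
    ⟨1, one_pos, fun x y => by simp only [hsymm x y, one_mul, le_refl]⟩,
    ⟨2 ^ β⁻¹, by positivity, fun x y z => ?_⟩⟩, ⟨K ^ β⁻¹, hKβ, fun x y => ⟨?_, hlower x y⟩⟩,
    fun r hr => ⟨fun x => ?_, ?_, ?_⟩⟩
  · refine ⟨fun hxy => ?_, fun hxy => ?_⟩
    · rw [← hd.eq_zero_iff]
      refine le_antisymm ?_ (hdnn x y)
      simpa only [hxy, mul_zero] using hlower x y
    · rw [hxy, h0, Real.zero_rpow (inv_ne_zero hβ.ne')]
  · rw [← (Real.monotoneOn_rpow_Ici_of_exponent_nonneg (inv_nonneg.2 hβ.le)).map_max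
      (hDnn x z) (hDnn z y), ← Real.mul_rpow two_pos.le (le_max_of_le_left (hDnn x z))]
    refine Real.rpow_le_rpow (hDnn x y) ((htri x z y).trans ?_) (inv_nonneg.2 hβ.le)
    linarith [le_max_left (D x z) (D z y), le_max_right (D x z) (D z y)]
  · exact (inv_mul_le_iff₀ hKβ).2 (hupper x y)
  · rw [hball x r hr]
    exact hX.measurableSet_qball_metric hK hβ (fun x y => (hD x y).1) htri x _
  · simp only [hball _ r hr]
    exact hX.measurable_measure_qball_metric hK hβ (fun x y => (hD x y).1) hsymm htri _
  · obtain ⟨c, hc, hcle⟩ := hX.exists_le_measure_qball h (r := r / K ^ β⁻¹) (by positivity)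
    refine (lintegral_mono (g := fun _ => c⁻¹) fun x => ?_).trans_lt ?_
    · refine ENNReal.inv_le_inv.2 ((hcle x).trans (measure_mono fun y hy => ?_))
      refine (hupper x y).trans_lt ?_
      rw [mem_qball, lt_div_iff₀ hKβ] at hy
      linarith
    · rw [lintegral_const]
      exact ENNReal.mul_lt_top (ENNReal.inv_lt_top.2 hc) (hX.measure_univ_lt_top h)

end Integrable

/-! ### Completeness and compactness in `L^p` for all `0 < p < ∞` -/

section Lp

variable {X : Type*} [MeasurableSpace X] {μ : Measure X}

/-- A crude constant that needs no convexity, so that exponents below `1` are treated together with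
the others. -/
theorem add_rpow_le_two_rpow_mul {P : ℝ} (hP : 0 ≤ P) (a b : ℝ≥0∞) :
    (a + b) ^ P ≤ 2 ^ P * (a ^ P + b ^ P) := by
  have h : a + b ≤ 2 * max a b := by
    rw [two_mul]
    exact add_le_add (le_max_left _ _) (le_max_right _ _)
  refine (ENNReal.rpow_le_rpow h hP).trans ?_
  rw [ENNReal.mul_rpow_of_nonneg _ _ hP]
  gcongr
  rcases le_total a b with hab | hab
  · rw [max_eq_right hab]
    exact le_add_self
  · rw [max_eq_left hab]
    exact le_self_add

theorem lintegral_enorm_sub_rpow_le {P : ℝ} (hP : 0 ≤ P) {u v w : X → ℝ} (hu : Measurable u)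
    (hw : Measurable w) :
    ∫⁻ x, ‖u x - v x‖ₑ ^ P ∂μ ≤
      2 ^ P * (∫⁻ x, ‖u x - w x‖ₑ ^ P ∂μ + ∫⁻ x, ‖v x - w x‖ₑ ^ P ∂μ) := by
  rw [← lintegral_add_left (by fun_prop), ← lintegral_const_mul' _ _ (by simp)]
  refine lintegral_mono fun x => ?_
  refine (ENNReal.rpow_le_rpow ?_ hP).trans (add_rpow_le_two_rpow_mul hP _ _)
  rw [enorm_sub_rev (v x)]
  calc ‖u x - v x‖ₑ = ‖(u x - w x) + (w x - v x)‖ₑ := by congr 1; ring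
    _ ≤ _ := enorm_add_le _ _

/-- Completeness of `L^p` for all exponents `p ∈ (0, ∞)`, in terms of `∫ |u|^p`. -/
theorem exists_tendsto_lintegral_rpow_of_cauchy {P : ℝ} (hP : 0 < P) {u : ℕ → X → ℝ}
    (hu : ∀ n, Measurable (u n))
    (hc : ∀ η : ℝ≥0∞, 0 < η → ∃ N, ∀ m ≥ N, ∀ n ≥ N, ∫⁻ x, ‖u m x - u n x‖ₑ ^ P ∂μ ≤ η) :
    ∃ f : X → ℝ, Measurable f ∧
      Tendsto (fun n => ∫⁻ x, ‖u n x - f x‖ₑ ^ P ∂μ) atTop (𝓝 0) := by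
  have h2 : ∀ j : ℕ, ((2 : ℝ≥0∞) ^ j) ^ P ≠ ∞ := fun j =>
    ENNReal.rpow_ne_top_of_nonneg hP.le (ENNReal.pow_ne_top (by simp))
  have h20 : ∀ j : ℕ, ((2 : ℝ≥0∞) ^ j) ^ P ≠ 0 := fun j =>
    (ENNReal.rpow_pos (by positivity) (ENNReal.pow_ne_top (by simp))).ne'
  -- The increments are so small that they remain summable after weighting by `(2 ^ j) ^ P`. Hence
  -- almost everywhere the `j`-th increment is at most a finite multiple of `2⁻¹ ^ j`, with no use
  -- of Minkowski's inequality.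
  obtain ⟨φ, hφ, hφe⟩ := extraction_forall_of_eventually'
    (P := fun j k => ∀ m ≥ k, ∫⁻ x, ‖u k x - u m x‖ₑ ^ P ∂μ ≤ 2⁻¹ ^ j / ((2 : ℝ≥0∞) ^ j) ^ P)
    (fun j => by
      obtain ⟨N, hN⟩ := hc (2⁻¹ ^ j / ((2 : ℝ≥0∞) ^ j) ^ P)
        (ENNReal.div_pos (pow_ne_zero _ (by simp)) (h2 j))
      exact ⟨N, fun k hk m hm => hN k hk m (hk.trans hm)⟩)
  have hae : ∀ᵐ x ∂μ, ∑' j : ℕ, ((2 : ℝ≥0∞) ^ j) ^ P * ‖u (φ j) x - u (φ (j + 1)) x‖ₑ ^ P < ∞ := by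
    refine ae_lt_top (by fun_prop) (ne_of_lt ?_)
    rw [lintegral_tsum (by fun_prop)]
    refine (ENNReal.tsum_le_tsum fun j => ?_).trans_lt
      (show ∑' j : ℕ, (2⁻¹ : ℝ≥0∞) ^ j < ∞ by
        rw [ENNReal.tsum_geometric, ENNReal.one_sub_inv_two, inv_inv]; simp)
    rw [lintegral_const_mul _ (by fun_prop)]
    refine (mul_le_mul_right (hφe j _ (hφ.monotone (Nat.le_succ j))) _).trans ?_
    rw [ENNReal.mul_div_cancel (h20 j) (h2 j)]
  have hlim : ∀ᵐ x ∂μ, ∃ l, Tendsto (fun j => u (φ j) x) atTop (𝓝 l) := by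
    filter_upwards [hae] with x hx
    refine cauchySeq_tendsto_of_complete ?_
    refine cauchySeq_of_edist_le_geometric 2⁻¹
      ((∑' j : ℕ, ((2 : ℝ≥0∞) ^ j) ^ P * ‖u (φ j) x - u (φ (j + 1)) x‖ₑ ^ P) ^ P⁻¹)
      (by simp) (ENNReal.rpow_ne_top_of_nonneg (inv_nonneg.2 hP.le) hx.ne) fun j => ?_
    have h1 := ENNReal.le_tsum (f := fun j : ℕ =>
      ((2 : ℝ≥0∞) ^ j) ^ P * ‖u (φ j) x - u (φ (j + 1)) x‖ₑ ^ P) j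
    rw [← ENNReal.mul_rpow_of_nonneg _ _ hP.le, ← ENNReal.le_rpow_inv_iff hP] at h1
    rw [edist_eq_enorm_sub, ← ENNReal.inv_pow, ← div_eq_mul_inv,
      ENNReal.le_div_iff_mul_le (by simp) (by simp), mul_comm]
    exact h1
  obtain ⟨f, hf, hft⟩ := measurable_limit_of_tendsto_metrizable_ae
    (fun j => (hu (φ j)).aemeasurable) hlim
  refine ⟨f, hf, ENNReal.tendsto_atTop_zero.2 fun η hη => ?_⟩
  obtain ⟨N, hN⟩ := hc η hη
  refine ⟨N, fun n hn => ?_⟩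
  -- Fatou's lemma upgrades the almost everywhere limit of the subsequence to convergence of the
  -- whole sequence.
  calc ∫⁻ x, ‖u n x - f x‖ₑ ^ P ∂μ
      = ∫⁻ x, liminf (fun j => ‖u n x - u (φ j) x‖ₑ ^ P) atTop ∂μ := by
        refine lintegral_congr_ae ?_
        filter_upwards [hft] with x hx
        refine (Tendsto.liminf_eq ?_).symm
        exact ((tendsto_const_nhds.sub hx).enorm).ennrpow_const P
    _ ≤ liminf (fun j => ∫⁻ x, ‖u n x - u (φ j) x‖ₑ ^ P ∂μ) atTop :=
        lintegral_liminf_le (by fun_prop)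
    _ ≤ η := by
        refine liminf_le_of_frequently_le' (Eventually.frequently ?_)
        filter_upwards [hφ.tendsto_atTop.eventually_ge_atTop N] with j hj
        exact hN n hn _ hj

/-- A sequence of functions that can be approximated in `L^p` by step functions with bounded
coefficients over finite partitions has a convergent subsequence. -/
theorem exists_subseq_tendsto_of_step_approx [IsFiniteMeasure μ] {P : ℝ} (hP : 0 < P)
    {u : ℕ → X → ℝ} (hu : ∀ n, Measurable (u n))
    (happ : ∀ η : ℝ≥0∞, 0 < η → ∃ (N : ℕ) (i : X → Fin N) (M : Fin N → ℝ), Measurable i ∧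
      ∀ n, ∃ c : Fin N → ℝ, (∀ k, |c k| ≤ M k) ∧ ∫⁻ x, ‖u n x - c (i x)‖ₑ ^ P ∂μ ≤ η) :
    ∃ (f : X → ℝ) (φ : ℕ → ℕ), Measurable f ∧ StrictMono φ ∧
      Tendsto (fun n => ∫⁻ x, ‖u (φ n) x - f x‖ₑ ^ P ∂μ) atTop (𝓝 0) := by
  choose N i M hi c hcM hc using fun m : ℕ => happ ((m : ℝ≥0∞) + 1)⁻¹ (by simp)
  -- The coefficients at all accuracies `m` together form a point of a countable product of compact
  -- boxes, so one subsequence works for every `m`, in place of a diagonal argument.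
  have hcpt : IsCompact (Set.univ.pi fun m => Set.univ.pi fun k => Set.Icc (-M m k) (M m k)) :=
    isCompact_univ_pi fun m => isCompact_univ_pi fun k => isCompact_Icc
  obtain ⟨a, -, φ, hφ, ha⟩ := hcpt.tendsto_subseq (x := fun n m => c m n)
    (fun n m _ k _ => abs_le.1 (hcM m n k))
  have hstep : ∀ m, Tendsto (fun n => ∫⁻ x, ‖c m (φ n) (i m x) - a m (i m x)‖ₑ ^ P ∂μ)
      atTop (𝓝 0) := by
    intro m
    have hcomp : ∀ k, Tendsto (fun n => ‖c m (φ n) k - a m k‖ₑ ^ P) atTop (𝓝 0) := by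
      intro k
      have h1 : Tendsto (fun n => c m (φ n) k) atTop (𝓝 (a m k)) :=
        tendsto_pi_nhds.1 (tendsto_pi_nhds.1 ha m) k
      have h2 := ((h1.sub_const (a m k)).enorm).ennrpow_const P
      simpa [hP] using h2
    have hsum : Tendsto (fun n => (∑ k, ‖c m (φ n) k - a m k‖ₑ ^ P) * μ Set.univ) atTop (𝓝 0) := by
      have h3 := tendsto_finsetSum Finset.univ fun k _ => hcomp k
      have h4 := ENNReal.Tendsto.mul_const (b := μ Set.univ) h3 (Or.inr (measure_ne_top _ _))
      simpa using h4
    refine tendsto_of_tendsto_of_tendsto_of_le_of_le tendsto_const_nhds hsum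
      (fun _ => zero_le) fun n => ?_
    dsimp only
    rw [← lintegral_const]
    exact lintegral_mono fun x => Finset.single_le_sum
      (f := fun k => ‖c m (φ n) k - a m k‖ₑ ^ P) (fun _ _ => zero_le) (Finset.mem_univ (i m x))
  have h2P : (2 : ℝ≥0∞) ^ P ≠ ∞ := by simp
  obtain ⟨f, hf, hft⟩ := exists_tendsto_lintegral_rpow_of_cauchy (μ := μ) hP
    (u := fun n => u (φ n)) (fun n => hu _) (fun η hη => by
      -- Two functions are compared through the common limit step function `a m`, and each with `a
      -- m` through its own step function: four errors, and two layers of the constant `2 ^ P`.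
      have hlim : Tendsto (fun m : ℕ => (2 : ℝ≥0∞) ^ P *
          (2 ^ P * (((m : ℝ≥0∞) + 1)⁻¹ + ((m : ℝ≥0∞) + 1)⁻¹) +
            2 ^ P * (((m : ℝ≥0∞) + 1)⁻¹ + ((m : ℝ≥0∞) + 1)⁻¹))) atTop (𝓝 0) := by
        have h0 : Tendsto (fun m : ℕ => ((m : ℝ≥0∞) + 1)⁻¹) atTop (𝓝 0) := by
          have := (tendsto_add_atTop_iff_nat 1).2 ENNReal.tendsto_inv_nat_nhds_zero
          simpa using this
        have h1 := ENNReal.Tendsto.const_mul (a := (2 : ℝ≥0∞) ^ P) (h0.add h0) (Or.inr h2P)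
        have h2 := ENNReal.Tendsto.const_mul (a := (2 : ℝ≥0∞) ^ P) (h1.add h1) (Or.inr h2P)
        simpa using h2
      obtain ⟨m, hm⟩ := (hlim.eventually (gt_mem_nhds hη)).exists
      obtain ⟨n₀, hn₀⟩ := ENNReal.tendsto_atTop_zero.1 (hstep m) ((m : ℝ≥0∞) + 1)⁻¹ (by simp)
      have hw : ∀ b : Fin (N m) → ℝ, Measurable fun x => b (i m x) := fun b =>
        (measurable_of_finite b).comp (hi m)
      have hone : ∀ n ≥ n₀, ∫⁻ x, ‖u (φ n) x - a m (i m x)‖ₑ ^ P ∂μ ≤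
          2 ^ P * (((m : ℝ≥0∞) + 1)⁻¹ + ((m : ℝ≥0∞) + 1)⁻¹) := fun n hn => by
        refine (lintegral_enorm_sub_rpow_le hP.le (hu _) (hw (c m (φ n)))).trans ?_
        gcongr
        · exact hc m (φ n)
        · simpa only [enorm_sub_rev] using hn₀ n hn
      refine ⟨n₀, fun n hn n' hn' => le_trans ?_ hm.le⟩
      refine (lintegral_enorm_sub_rpow_le hP.le (hu _) (hw (a m))).trans ?_
      gcongr
      · exact hone n hn
      · exact hone n' hn')
  exact ⟨f, φ, hf, hφ, hft⟩

end Lp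

/-! ### Compact embeddings on totally bounded spaces -/

section Compactness

variable {X : Type*} [MeasurableSpace X] {d : X → X → ℝ} {μ : Measure X}

/-- Each `g k` is thereby controlled in `L^p` by either mixed norm, so both scales of spaces reduce
to a bound in `ℓ^∞(L^p)`. -/
theorem le_ellNorm {q : ℝ≥0∞} (hq : 0 < q) (a : ℤ → ℝ≥0∞) (k : ℤ) : a k ≤ ellNorm q a := by
  unfold ellNorm
  split_ifs with h
  · exact le_iSup a k
  · have hq' : 0 < q.toReal := ENNReal.toReal_pos hq.ne' h
    rw [one_div, ENNReal.le_rpow_inv_iff hq']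
    exact ENNReal.le_tsum k

/-- Functions with a fractional gradient `g` that is bounded in `ℓ^∞(L^p)` have a modulus of
continuity that is small in `L^p`. -/
theorem exists_modulus (hd : IsQuasiMetric d) {α : ℝ} (hα : 0 < α) {p : ℝ≥0∞} (hp : 0 < p)
    (hp' : p < ∞) {A : ℝ≥0∞} (hA : A < ∞) {η : ℝ≥0∞} (hη : 0 < η) :
    ∃ r : ℝ, 0 < r ∧ ∀ (u : X → ℝ) (g : ℤ → X → ℝ≥0∞), IsFracGradient d μ α u g →
      (∀ k, eLpNorm (g k) p μ ≤ A) → ∃ H : X → ℝ≥0∞, Measurable H ∧ ∫⁻ x, H x ∂μ ≤ η ∧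
        ∃ E : Set X, μ E = 0 ∧ ∀ x y, x ∉ E → y ∉ E → d x y < r →
          ‖u x - u y‖ₑ ^ p.toReal ≤ H x + H y := by
  set P := p.toReal with hPdef
  have hP : 0 < P := ENNReal.toReal_pos hp.ne' hp'.ne
  -- `w k` bounds `d ^ (α P)` on the `k`-th dyadic annulus. It is summable, so the scales `k ≥ K`
  -- together contribute little.
  set w : ℕ → ℝ≥0∞ := fun j => ENNReal.ofReal (((2 : ℝ) ^ (-α)) ^ j) ^ P with hw
  have hwsum : ∑' j, w j ≠ ∞ := by
    have h1 : ∀ j, w j = (ENNReal.ofReal ((2 : ℝ) ^ (-α)) ^ P) ^ j := fun j => by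
      rw [hw]
      dsimp only
      rw [ENNReal.ofReal_pow (by positivity), ← ENNReal.rpow_natCast, ← ENNReal.rpow_natCast,
        ← ENNReal.rpow_mul, ← ENNReal.rpow_mul, mul_comm]
    have h2 : ENNReal.ofReal ((2 : ℝ) ^ (-α)) ^ P < 1 := by
      refine ENNReal.rpow_lt_one ?_ hP
      rw [ENNReal.ofReal_lt_one]
      exact Real.rpow_lt_one_of_one_lt_of_neg one_lt_two (neg_neg_of_pos hα)
    simp only [h1]
    rw [ENNReal.tsum_geometric]
    exact ENNReal.inv_ne_top.2 (tsub_pos_of_lt h2).ne'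
  have hlim : Tendsto (fun K => 2 ^ P * (A ^ P * ∑' j, w (j + K))) atTop (𝓝 0) := by
    have h1 := ENNReal.Tendsto.const_mul (a := A ^ P) (ENNReal.tendsto_sum_nat_add w hwsum)
      (Or.inr (ENNReal.rpow_ne_top_of_nonneg hP.le hA.ne))
    have h2 := ENNReal.Tendsto.const_mul (a := (2 : ℝ≥0∞) ^ P) h1 (Or.inr (by simp))
    simpa using h2
  obtain ⟨K, hK⟩ := (hlim.eventually (gt_mem_nhds hη)).exists
  refine ⟨(2 : ℝ) ^ (-(K : ℤ)), by positivity, fun u g hg hgA => ?_⟩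
  obtain ⟨hgm, E, -, hE0, hgE⟩ := hg
  have hgint : ∀ k, ∫⁻ x, g k x ^ P ∂μ ≤ A ^ P := fun k => by
    have h1 := hgA k
    rw [eLpNorm_eq_lintegral_rpow_enorm_toReal hp.ne' hp'.ne, ← hPdef, one_div,
      ENNReal.rpow_inv_le_iff hP] at h1
    simpa using h1
  -- `H` sums the gradients over all scales `k ≥ K`; a given pair `x, y` uses only one term.
  refine ⟨fun x => 2 ^ P * ∑' j : ℕ, w (j + K) * g ((j + K : ℕ) : ℤ) x ^ P, by fun_prop, ?_,
    E, hE0, fun x y hx hy hxy => ?_⟩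
  · rw [lintegral_const_mul _ (by fun_prop), lintegral_tsum (by fun_prop)]
    refine le_trans ?_ hK.le
    rw [← ENNReal.tsum_mul_left (a := A ^ P)]
    refine mul_le_mul_right (ENNReal.tsum_le_tsum fun j => ?_) _
    rw [lintegral_const_mul _ (by fun_prop), mul_comm]
    gcongr
    exact hgint _
  · rcases eq_or_ne x y with rfl | hne
    · simp [hP]
    -- `2 ^ n ≤ d x y < 2 ^ (n + 1)` is the annulus of index `k = -n - 1`, and `d x y < 2 ^ (-K)`
    -- gives `k ≥ K`.
    obtain ⟨n, hn1, hn2⟩ := exists_mem_Ico_zpow (hd.pos hne) one_lt_two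
    have hnK : n < -(K : ℤ) := (zpow_lt_zpow_iff_right₀ one_lt_two).1 (hn1.trans_lt hxy)
    obtain ⟨j, hj⟩ : ∃ j : ℕ, ((j + K : ℕ) : ℤ) = -n - 1 := ⟨(-n - 1 - K).toNat, by omega⟩
    have h1 := hgE ((j + K : ℕ) : ℤ) x y hx hy (by rwa [hj, show -(-n - 1) - 1 = n by ring])
      (by rwa [hj, show -(-n - 1) = n + 1 by ring])
    rw [← Real.enorm_eq_ofReal_abs] at h1
    have h2 : ENNReal.ofReal (d x y ^ α) ≤ ENNReal.ofReal (((2 : ℝ) ^ (-α)) ^ (j + K)) := by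
      refine ENNReal.ofReal_le_ofReal ?_
      have h3 : d x y ≤ (2 : ℝ) ^ (-((j + K : ℕ) : ℝ)) := by
        refine hn2.le.trans (le_of_eq ?_)
        rw [← Real.rpow_intCast]
        congr 1
        have : (((j + K : ℕ) : ℤ) : ℝ) = ((-n - 1 : ℤ) : ℝ) := by rw [hj]
        push_cast at this ⊢
        linarith
      refine (Real.rpow_le_rpow (hd.nonneg x y) h3 hα.le).trans (le_of_eq ?_)
      rw [← Real.rpow_natCast, ← Real.rpow_mul two_pos.le, ← Real.rpow_mul two_pos.le]
      congr 1
      ring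
    calc ‖u x - u y‖ₑ ^ P
        ≤ (ENNReal.ofReal (((2 : ℝ) ^ (-α)) ^ (j + K)) *
            (g ((j + K : ℕ) : ℤ) x + g ((j + K : ℕ) : ℤ) y)) ^ P :=
          ENNReal.rpow_le_rpow (h1.trans (mul_le_mul_left h2 _)) hP.le
      _ = w (j + K) * (g ((j + K : ℕ) : ℤ) x + g ((j + K : ℕ) : ℤ) y) ^ P :=
          ENNReal.mul_rpow_of_nonneg _ _ hP.le
      _ ≤ w (j + K) * (2 ^ P * (g ((j + K : ℕ) : ℤ) x ^ P + g ((j + K : ℕ) : ℤ) y ^ P)) := by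
          gcongr
          exact add_rpow_le_two_rpow_mul hP.le _ _
      _ = 2 ^ P * (w (j + K) * g ((j + K : ℕ) : ℤ) x ^ P) +
            2 ^ P * (w (j + K) * g ((j + K : ℕ) : ℤ) y ^ P) := by ring
      _ ≤ _ := by
          refine add_le_add (mul_le_mul_right ?_ _) (mul_le_mul_right ?_ _)
          · exact ENNReal.le_tsum (f := fun j : ℕ => w (j + K) * g ((j + K : ℕ) : ℤ) x ^ P) j
          · exact ENNReal.le_tsum (f := fun j : ℕ => w (j + K) * g ((j + K : ℕ) : ℤ) y ^ P) j

/-- A totally bounded space has finite measurable partitions into sets of small diameter. -/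
theorem IsQuasiMetricMeasureSpace.exists_partition [Nontrivial X]
    (hX : IsQuasiMetricMeasureSpace d μ) (h : IsTotallyBounded d) {r : ℝ} (hr : 0 < r) :
    ∃ (N : ℕ) (i : X → Fin N), Measurable i ∧ ∀ x y, i x = i y → d x y < r := by
  have hd := hX.isQuasiMetric
  obtain ⟨C, hC1, hC⟩ := hd.exists_symm_const
  have hK := hd.one_le_optConst
  have hK0 : 0 < optConst d := by linarith
  have hC0 : 0 < C := by linarith
  set ε := r / (optConst d * C)
  have hε : 0 < ε := by positivity
  have hεr : optConst d * (C * ε) = r := by simp only [ε]; field_simp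
  obtain ⟨t, ht⟩ := h ε hε
  classical
  have hcov : ∀ y, ∃ j : Fin t.card, d (t.equivFin.symm j) y < ε := fun y => by
    have : y ∈ ⋃ x ∈ t, qball d x ε := ht ▸ Set.mem_univ y
    simp only [Set.mem_iUnion] at this
    obtain ⟨x, hx, hxy⟩ := this
    exact ⟨t.equivFin ⟨x, hx⟩, by simpa using mem_qball.1 hxy⟩
  -- Sending a point to the first ball of the cover containing it makes the cover disjoint.
  refine ⟨t.card, fun y => Fin.find _ (hcov y), ?_, fun x y hxy => ?_⟩
  · refine measurable_to_countable' fun j => ?_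
    have : (fun y => Fin.find _ (hcov y)) ⁻¹' {j} =
        qball d (t.equivFin.symm j) ε \ ⋃ k ∈ Finset.Iio j, qball d (t.equivFin.symm k) ε := by
      ext y
      simp [Fin.find_eq_iff, mem_qball]
    rw [this]
    exact (hX.measurableSet_qball _ _ hε).diff
      (Finset.measurableSet_biUnion _ fun k _ => hX.measurableSet_qball _ _ hε)
  · have hx := Fin.find_spec (hcov x)
    have hy := Fin.find_spec (hcov y)
    dsimp only at hxy
    rw [← hxy] at hy
    set z : X := (t.equivFin.symm (Fin.find _ (hcov x))).1
    have h1 : d x z < C * ε := (hC z x).trans_lt (mul_lt_mul_of_pos_left hx hC0)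
    have h2 : d z y < C * ε := by nlinarith
    rw [← hεr]
    exact (hd.le_optConst_mul x y z).trans_lt (mul_lt_mul_of_pos_left (max_lt h1 h2) hK0)

/-- The constant is the value of `u` at a point where `H` does not exceed its average over `B`.
Averaging `u` itself is avoided, since `u` need not be integrable when `P < 1`. -/
theorem exists_const_lintegral_sub_le {P : ℝ} {u : X → ℝ} {H : X → ℝ≥0∞}
    (hH : Measurable H) {E : Set X} (hE : μ E = 0)
    {B : Set X} (hB : MeasurableSet B) (hBfin : μ B ≠ ∞)
    (huH : ∀ x ∈ B, ∀ y ∈ B, x ∉ E → y ∉ E → ‖u x - u y‖ₑ ^ P ≤ H x + H y) (hB0 : μ B ≠ 0) :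
    ∃ c : ℝ, ∫⁻ x in B, ‖u x - c‖ₑ ^ P ∂μ ≤ 2 * ∫⁻ x in B, H x ∂μ := by
  have : IsFiniteMeasure (μ.restrict B) := ⟨by simpa using hBfin.lt_top⟩
  have hBE : ∀ᵐ x ∂μ.restrict B, x ∈ B ∧ x ∉ E := by
    filter_upwards [ae_restrict_mem hB, ae_restrict_of_ae (measure_eq_zero_iff_ae_notMem.1 hE)]
      with x h1 h2 using ⟨h1, h2⟩
  obtain ⟨y, hy, hyH⟩ := exists_notMem_null_le_laverage (μ := μ.restrict B) (f := H)
    (N := {x | ¬ (x ∈ B ∧ x ∉ E)}) (by simpa using hB0) hH.aemeasurable hBE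
  have hy' : y ∈ B ∧ y ∉ E := by simpa using hy
  refine ⟨u y, ?_⟩
  calc ∫⁻ x in B, ‖u x - u y‖ₑ ^ P ∂μ ≤ ∫⁻ x in B, (H x + H y) ∂μ := by
        refine lintegral_mono_ae ?_
        filter_upwards [hBE] with x hx using huH x hx.1 y hy'.1 hx.2 hy'.2
    _ = ∫⁻ x in B, H x ∂μ + H y * μ B := by
        rw [lintegral_add_left hH, setLIntegral_const]
    _ ≤ ∫⁻ x in B, H x ∂μ + ∫⁻ x in B, H x ∂μ := by
        gcongr
        rw [setLAverage_eq] at hyH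
        exact (ENNReal.le_div_iff_mul_le (Or.inl hB0) (Or.inl hBfin)).1 hyH
    _ = _ := (two_mul _).symm

/-- Step function approximation over a finite partition, with control on the coefficients. -/
theorem exists_step_approx [IsFiniteMeasure μ] {P : ℝ} (hP : 0 < P) {N : ℕ} {i : X → Fin N}
    (hi : Measurable i) {A η : ℝ≥0∞} (hA : A < ∞) (hη : η < ∞) :
    ∃ M : Fin N → ℝ, ∀ (u : X → ℝ) (H : X → ℝ≥0∞) (E : Set X), Measurable u →
      ∫⁻ x, ‖u x‖ₑ ^ P ∂μ ≤ A → Measurable H → 2 * ∫⁻ x, H x ∂μ ≤ η → μ E = 0 →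
      (∀ x y, x ∉ E → y ∉ E → i x = i y → ‖u x - u y‖ₑ ^ P ≤ H x + H y) →
      ∃ c : Fin N → ℝ, (∀ k, |c k| ≤ M k) ∧ ∫⁻ x, ‖u x - c (i x)‖ₑ ^ P ∂μ ≤ η := by
  -- Chebyshev's bound on a cell, as the step function has `P`-th power integral at most `2 ^ P * (A
  -- + η)`; it does not depend on `u`. On null cells this gives no control, so the coefficient is
  -- set to `0` there.
  refine ⟨fun k => (((2 ^ P * (A + η)) / μ (i ⁻¹' {k})) ^ P⁻¹).toReal,
    fun u H E hu huA hH hHη hE huH => ?_⟩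
  have hms : ∀ k, MeasurableSet (i ⁻¹' {k}) := fun k => hi (measurableSet_singleton k)
  have hsplit : ∀ F : X → ℝ≥0∞, ∫⁻ x, F x ∂μ = ∑ k, ∫⁻ x in i ⁻¹' {k}, F x ∂μ := fun F => by
    have hU : (⋃ k ∈ (Finset.univ : Finset (Fin N)), i ⁻¹' {k}) = Set.univ := by
      ext x; simp
    rw [← setLIntegral_univ, ← hU, lintegral_biUnion_finset _ (fun k _ => hms k)]
    intro a _ b _ hab
    exact Disjoint.preimage _ (by simpa using hab)
  have hex : ∀ k, ∃ c : ℝ, (μ (i ⁻¹' {k}) = 0 → c = 0) ∧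
      ∫⁻ x in i ⁻¹' {k}, ‖u x - c‖ₑ ^ P ∂μ ≤ 2 * ∫⁻ x in i ⁻¹' {k}, H x ∂μ := fun k => by
    by_cases h0 : μ (i ⁻¹' {k}) = 0
    · exact ⟨0, fun _ => rfl, by rw [Measure.restrict_eq_zero.2 h0]; simp⟩
    · obtain ⟨c, hc⟩ := exists_const_lintegral_sub_le hH hE (hms k) (measure_ne_top _ _)
        (fun x hx y hy hxE hyE => huH x y hxE hyE (hx.trans hy.symm)) h0
      exact ⟨c, fun h => absurd h h0, hc⟩
  choose c hc0 hc using hex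
  have hcη : ∫⁻ x, ‖u x - c (i x)‖ₑ ^ P ∂μ ≤ η := by
    refine le_trans ?_ hHη
    rw [hsplit, hsplit H, Finset.mul_sum]
    refine Finset.sum_le_sum fun k _ => le_trans (le_of_eq ?_) (hc k)
    exact setLIntegral_congr_fun (hms k) fun x hx => by rw [show i x = k from hx]
  refine ⟨c, fun k => ?_, hcη⟩
  by_cases h0 : μ (i ⁻¹' {k}) = 0
  · rw [hc0 k h0, abs_zero]
    exact ENNReal.toReal_nonneg
  · have hfin : ((2 ^ P * (A + η)) / μ (i ⁻¹' {k})) ^ P⁻¹ ≠ ∞ := by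
      refine ENNReal.rpow_ne_top_of_nonneg (inv_nonneg.2 hP.le) (ENNReal.div_ne_top ?_ h0)
      exact ENNReal.mul_ne_top (by simp) (ENNReal.add_ne_top.2 ⟨hA.ne, hη.ne⟩)
    rw [← ENNReal.ofReal_le_iff_le_toReal hfin, ← Real.enorm_eq_ofReal_abs,
      ENNReal.le_rpow_inv_iff hP,
      ENNReal.le_div_iff_mul_le (Or.inl h0) (Or.inl (measure_ne_top _ _))]
    have hw : Measurable fun x => c (i x) := (measurable_of_finite c).comp hi
    have h1 := lintegral_enorm_sub_rpow_le (μ := μ) hP.le (v := fun _ => 0) hw hu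
    simp only [sub_zero, zero_sub, enorm_neg] at h1
    calc ‖c k‖ₑ ^ P * μ (i ⁻¹' {k}) = ∫⁻ x in i ⁻¹' {k}, ‖c (i x)‖ₑ ^ P ∂μ := by
          rw [← setLIntegral_const]
          exact setLIntegral_congr_fun (hms k) fun x hx => by rw [show i x = k from hx]
      _ ≤ ∫⁻ x, ‖c (i x)‖ₑ ^ P ∂μ := setLIntegral_le_lintegral _ _
      _ ≤ _ := h1
      _ ≤ 2 ^ P * (A + η) := by
          rw [add_comm A]
          gcongr
          simpa only [enorm_sub_rev] using hcη

/-- On a totally bounded space, spaces of functions with fractional gradients that are bounded in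
`ℓ^∞(L^p)` embed compactly into `L^p`. -/
theorem embedsCompactly_of_isTotallyBounded [Nontrivial X]
    (hX : IsQuasiMetricMeasureSpace d μ) (h : IsTotallyBounded d) {α : ℝ} (hα : 0 < α)
    {p : ℝ≥0∞} (hp : 0 < p) (hp' : p < ∞) {S : Set (X → ℝ)} {N : (X → ℝ) → ℝ≥0∞}
    (hS : ∀ u ∈ S, Measurable u ∧ MemLp u p μ) (hN : ∀ u, eLpNorm u p μ ≤ N u)
    (hgrad : ∀ u ∈ S, ∀ C < ∞, N u < C → ∃ g, IsFracGradient d μ α u g ∧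
      ∀ k, eLpNorm (g k) p μ ≤ C) : EmbedsCompactly S N p μ := by
  refine ⟨fun u hu => (hS u hu).2, ?_⟩
  rintro u huS ⟨C, hC, huC⟩
  have hfin : IsFiniteMeasure μ := ⟨hX.measure_univ_lt_top h⟩
  have hP : 0 < p.toReal := ENNReal.toReal_pos hp.ne' hp'.ne
  have hnorm : ∀ v : X → ℝ, eLpNorm v p μ = (∫⁻ x, ‖v x‖ₑ ^ p.toReal ∂μ) ^ p.toReal⁻¹ := fun v => by
    rw [eLpNorm_eq_lintegral_rpow_enorm_toReal hp.ne' hp'.ne, one_div]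
  obtain ⟨f, φ, hf, hφ, hlim⟩ := exists_subseq_tendsto_of_step_approx (μ := μ) hP
    (fun n => (hS _ (huS n)).1) (fun η hη => by
      -- `η` may be infinite, whereas the coefficient bounds need a finite error.
      set η' := min η 1
      have hη' : 0 < η' := lt_min hη one_pos
      have hη1 : η' < ∞ := (min_le_right _ _).trans_lt (by simp)
      -- Half of `η'` pays for the factor `2` in the step approximation. `C + 1` leaves room because
      -- the infimum defining the semi-norm need not be attained.
      obtain ⟨r, hr, hmod⟩ := exists_modulus (μ := μ) hX.isQuasiMetric hα hp hp'
        (A := C + 1) (by simpa using hC) (η := η' / 2) (ENNReal.div_pos hη'.ne' (by simp))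
      obtain ⟨m, i, hi, hir⟩ := hX.exists_partition h hr
      obtain ⟨M, hM⟩ := exists_step_approx (μ := μ) hP hi (A := C ^ p.toReal)
        (ENNReal.rpow_lt_top_of_nonneg hP.le hC.ne) hη1
      refine ⟨m, i, M, hi, fun n => ?_⟩
      obtain ⟨g, hg, hgC⟩ := hgrad _ (huS n) (C + 1) (by simpa using hC)
        ((huC n).trans_lt (ENNReal.lt_add_right hC.ne (by simp)))
      obtain ⟨H, hH, hHη, E, hE, huH⟩ := hmod _ g hg hgC
      obtain ⟨c, hcM, hc⟩ := hM (u n) H E (hS _ (huS n)).1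
        (by
          have := (hN (u n)).trans (huC n)
          rwa [hnorm, ENNReal.rpow_inv_le_iff hP] at this) hH
        (by
          refine (mul_le_mul_right hHη 2).trans (le_of_eq ?_)
          exact ENNReal.mul_div_cancel (by simp) (by simp)) hE
        (fun x y hx hy hxy => huH x y hx hy (hir x y hxy))
      exact ⟨c, hcM, hc.trans (min_le_left _ _)⟩)
  have hlim' : Tendsto (fun n => eLpNorm (u (φ n) - f) p μ) atTop (𝓝 0) := by
    have h1 := hlim.ennrpow_const p.toReal⁻¹
    rw [ENNReal.zero_rpow_of_pos (inv_pos.2 hP)] at h1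
    simpa only [hnorm, Pi.sub_apply] using h1
  refine ⟨f, φ, ?_, hφ, hlim'⟩
  obtain ⟨n, hn⟩ := (hlim'.eventually (gt_mem_nhds one_pos)).exists
  have h1 : MemLp (u (φ n) - f) p μ :=
    ⟨((hS _ (huS _)).1.sub hf).aestronglyMeasurable, hn.trans (by simp)⟩
  have h2 := (hS _ (huS (φ n))).2.sub h1
  rwa [sub_sub_cancel] at h2

theorem compactEmbM_of_isTotallyBounded [Nontrivial X] (hX : IsQuasiMetricMeasureSpace d μ)
    (h : IsTotallyBounded d) {α : ℝ} (hα : 0 < α) {p q : ℝ≥0∞} (hp : 0 < p) (hp' : p < ∞)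
    (hq : 0 < q) : CompactEmbM d μ α p q := by
  refine embedsCompactly_of_isTotallyBounded hX h hα hp hp' (fun u hu => ⟨hu.1, hu.2.1⟩)
    (fun u => le_self_add) fun u _ C _ huC => ?_
  have h1 : homSeminormM d μ α p q u < C := lt_of_le_of_lt le_add_self huC
  simp only [homSeminormM, iInf_lt_iff] at h1
  obtain ⟨g, hg, hgC⟩ := h1
  refine ⟨g, hg, fun k => le_trans (eLpNorm_mono_enorm fun x => ?_) hgC.le⟩
  exact le_ellNorm hq (fun k => g k x) k

theorem compactEmbN_of_isTotallyBounded [Nontrivial X] (hX : IsQuasiMetricMeasureSpace d μ)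
    (h : IsTotallyBounded d) {α : ℝ} (hα : 0 < α) {p q : ℝ≥0∞} (hp : 0 < p) (hp' : p < ∞)
    (hq : 0 < q) : CompactEmbN d μ α p q := by
  refine embedsCompactly_of_isTotallyBounded hX h hα hp hp' (fun u hu => ⟨hu.1, hu.2.1⟩)
    (fun u => le_self_add) fun u _ C _ huC => ?_
  have h1 : homSeminormN d μ α p q u < C := lt_of_le_of_lt le_add_self huC
  simp only [homSeminormN, iInf_lt_iff] at h1
  obtain ⟨g, hg, hgC⟩ := h1
  exact ⟨g, hg, fun k => (le_ellNorm hq (fun k => eLpNorm (g k) p μ) k).trans hgC.le⟩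

end Compactness

/-! ### Admissible exponents and Hölder bump functions -/

section Bumps

variable {X : Type*}

theorem rpow_le_two_of_le_smoothness [Nontrivial X] {ρ : X → X → ℝ} (hρ : IsQuasiMetric ρ)
    {β : ℝ} (hβ : 0 < β) (h : ENNReal.ofReal β ≤ smoothness ρ) : optConst ρ ^ β ≤ 2 := by
  have h1 := hρ.one_le_optConst
  rw [smoothness, ENNReal.le_inv_iff_mul_le, ← ENNReal.ofReal_mul hβ.le, ENNReal.ofReal_le_one] at h
  rw [← Real.rpow_one 2, ← Real.logb_le_iff_le_rpow one_lt_two (by positivity),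
    Real.logb_rpow_eq_mul_logb_of_pos (by linarith)]
  exact h

/-- Below the index there is room for some `β > α`. At the index the supremum is attained, and `β =
α` is acceptable because then `q = ∞`. -/
theorem Admissible.exists_exponent [Nontrivial X] {d : X → X → ℝ} {α : ℝ} {q : ℝ≥0∞} (hα : 0 < α)
    (h : Admissible d α q) :
    ∃ (ρ : X → X → ℝ) (β : ℝ), IsQuasiMetric ρ ∧ Equivalent d ρ ∧ optConst ρ ^ β ≤ 2 ∧ α ≤ β ∧
      (q = ∞ ∨ α < β) := by
  rcases h.1.eq_or_lt with heq | hlt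
  · obtain ⟨hq, ρ, hρ, hdρ, hs⟩ := h.2 heq
    exact ⟨ρ, α, hρ, hdρ, rpow_le_two_of_le_smoothness hρ hα (by rw [heq, hs]), le_rfl, Or.inl hq⟩
  · simp only [ind, lt_iSup_iff] at hlt
    obtain ⟨ρ, ⟨hρ, hdρ⟩, hlt⟩ := hlt
    obtain ⟨β, h1, h2⟩ := ENNReal.lt_iff_exists_nnreal_btwn.1 hlt
    rw [← ENNReal.ofReal_coe_nnreal] at h1 h2
    have hαβ : α < β := (ENNReal.ofReal_lt_ofReal_iff_of_nonneg hα.le).1 h1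
    exact ⟨ρ, β, hρ, hdρ, rpow_le_two_of_le_smoothness hρ (hα.trans hαβ) h2.le, hαβ.le, Or.inr hαβ⟩

theorem IsQuasiMetric.exists_admissible {d : X → X → ℝ} (hd : IsQuasiMetric d)
    (q : ℝ≥0∞) : ∃ α : ℝ, 0 < α ∧ Admissible d α q := by
  have h1 : 0 < ind d := by
    refine lt_of_lt_of_le ?_ (le_iSup₂_of_le (f := fun (ρ : X → X → ℝ)
      (_ : IsQuasiMetric ρ ∧ Equivalent d ρ) => smoothness ρ) d ⟨hd, Equivalent.refl d⟩ le_rfl)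
    exact ENNReal.inv_pos.2 ENNReal.ofReal_ne_top
  obtain ⟨α, h2, h3⟩ := ENNReal.lt_iff_exists_nnreal_btwn.1 h1
  refine ⟨α, by exact_mod_cast h2, ?_, fun h => ?_⟩
  · rw [ENNReal.ofReal_coe_nnreal]
    exact h3.le
  · rw [ENNReal.ofReal_coe_nnreal] at h
    exact absurd h h3.ne

variable [MeasurableSpace X] {d : X → X → ℝ} {μ : Measure X}

/-- Doubling is iterated from `R` down through `R / K ^ n` until the radius is at most `r`; this
needs `K > 1`. -/
theorem exists_measure_qball_le_mul {K δ₀ R r : ℝ} (hK : 1 < K)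
    (hdoub : ∀ δ : ℝ, 0 < δ → δ ≤ δ₀ → IsDoublingAt d μ K δ) (hR : 0 < R) (hRδ : R ≤ δ₀)
    (hr : 0 < r) : ∃ C : ℝ≥0∞, C < ∞ ∧ ∀ x, μ (qball d x R) ≤ C * μ (qball d x r) := by
  have hK0 : 0 < K := by linarith
  have key : ∀ n : ℕ, ∃ C : ℝ≥0∞, C < ∞ ∧ ∀ x, μ (qball d x R) ≤ C * μ (qball d x (R / K ^ n)) := by
    intro n
    induction n with
    | zero => exact ⟨1, by simp, fun x => by simp⟩
    | succ n ih =>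
      obtain ⟨C, hC, h⟩ := ih
      have hle : R / K ^ (n + 1) ≤ R := div_le_self hR.le (one_le_pow₀ hK.le)
      obtain ⟨C', -, h'⟩ := hdoub (R / K ^ (n + 1)) (by positivity) (hle.trans hRδ)
      refine ⟨C * ENNReal.ofReal C', ENNReal.mul_lt_top hC ENNReal.ofReal_lt_top, fun x => ?_⟩
      have h1 : K * (R / K ^ (n + 1)) = R / K ^ n := by rw [pow_succ]; field_simp
      have h2 := h' x
      rw [h1] at h2
      rw [mul_assoc]
      exact (h x).trans (mul_le_mul_right h2 _)
  obtain ⟨n, hn⟩ := pow_unbounded_of_one_lt (R / r) hK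
  obtain ⟨C, hC, h⟩ := key n
  refine ⟨C, hC, fun x => (h x).trans (mul_le_mul_right (measure_mono (qball_mono x ?_)) _)⟩
  rw [div_lt_iff₀ hr] at hn
  rw [div_le_iff₀ (by positivity)]
  linarith

theorem abs_clamp_sub_clamp_le (a b : ℝ) :
    |max 0 (min 1 a) - max 0 (min 1 b)| ≤ |a - b| := by
  refine (abs_max_sub_max_le_max 0 _ 0 _).trans ?_
  rw [sub_self, abs_zero, max_eq_right (abs_nonneg _)]
  refine (abs_min_sub_min_le_max 1 _ 1 _).trans ?_
  rw [sub_self, abs_zero, max_eq_right (abs_nonneg _)]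

/-- Hölder continuous bump functions at a small scale, for pairs of balls of comparable measure. -/
theorem IsQuasiMetricMeasureSpace.exists_bump [Nontrivial X] (hX : IsQuasiMetricMeasureSpace d μ)
    (hdoub : ∃ δ₀ : ℝ, 0 < δ₀ ∧ ∀ δ : ℝ, 0 < δ → δ ≤ δ₀ → IsDoublingAt d μ (optConst d) δ)
    {ρ : X → X → ℝ} (hρ : IsQuasiMetric ρ) (hdρ : Equivalent d ρ) {β : ℝ} (hβ : 0 < β)
    (hC : optConst ρ ^ β ≤ 2) {R₀ : ℝ} (hR₀ : 0 < R₀) :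
    ∃ (r R L : ℝ) (C : ℝ≥0∞), 0 < r ∧ 0 < R ∧ R ≤ R₀ ∧ 0 ≤ L ∧ C < ∞ ∧
      (∀ x, μ (qball d x R) ≤ C * μ (qball d x r)) ∧
      ∀ x, ∃ φ : X → ℝ, Measurable φ ∧ (∀ y, 0 ≤ φ y ∧ φ y ≤ 1) ∧
        (∀ y ∈ qball d x r, φ y = 1) ∧ (∀ y ∉ qball d x R, φ y = 0) ∧
        ∀ y z, |φ y - φ z| ≤ L * d y z ^ β := by
  have hd := hX.isQuasiMetric
  -- When `C_d = 1` the doubling condition is empty, but points inside and outside a ball are then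
  -- at least `R₀ / C₀` apart in either order. The indicator of the ball is thus Hölder, and `r = R`
  -- is allowed.
  rcases hd.one_le_optConst.eq_or_lt with h1 | h1
  · obtain ⟨C₀, hC₀1, hC₀⟩ := hd.exists_symm_const
    have hC₀0 : 0 < C₀ := by linarith
    have hsep : ∀ x y z, d x y < R₀ → ¬ d x z < R₀ → R₀ ≤ d y z := fun x y z hy hz => by
      have h2 := hd.le_optConst_mul x z y
      rw [← h1, one_mul] at h2
      rcases le_max_iff.1 ((not_lt.1 hz).trans h2) with h | h
      · exact absurd hy (not_lt.2 h)
      · exact h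
    have hone : ∀ y z, R₀ ≤ C₀ * d y z → 1 ≤ (C₀ / R₀) ^ β * d y z ^ β := fun y z h => by
      rw [← Real.mul_rpow (by positivity) (hd.nonneg y z)]
      refine Real.one_le_rpow ?_ hβ.le
      rw [div_mul_eq_mul_div, le_div_iff₀ hR₀]
      linarith
    refine ⟨R₀, R₀, (C₀ / R₀) ^ β, 1, hR₀, hR₀, le_rfl, by positivity, by simp, by simp, fun x =>
      ⟨(qball d x R₀).indicator 1, measurable_one.indicator (hX.measurableSet_qball x _ hR₀),
        fun y => ⟨Set.indicator_nonneg (by simp) _, Set.indicator_le_self' (by simp) _⟩,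
        fun y hy => by simp [hy], fun y hy => by simp [hy], fun y z => ?_⟩⟩
    by_cases hy : y ∈ qball d x R₀ <;> by_cases hz : z ∈ qball d x R₀
    · simpa [hy, hz] using mul_nonneg (by positivity) (Real.rpow_nonneg (hd.nonneg y z) β)
    · have h2 := hsep x y z hy hz
      simpa [hy, hz] using hone y z (by nlinarith)
    · have h2 := hsep x z y hz hy
      simpa [hy, hz] using hone y z (h2.trans (hC₀ y z))
    · simpa [hy, hz] using mul_nonneg (by positivity) (Real.rpow_nonneg (hd.nonneg y z) β)
  · obtain ⟨δ₀, hδ₀, hdoub⟩ := hdoub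
    obtain ⟨D, K, hK, h0, hsymm, htri, hD⟩ := hd.exists_metric_rpow hρ hdρ hβ hC
    set R := min R₀ δ₀
    have hR : 0 < R := lt_min hR₀ hδ₀
    -- With this `s`, one has `D x y ≥ 2 * s` off the ball of radius `R`, and `D x y < s` on the
    -- ball of radius `(s / K) ^ β⁻¹`. The bump is `2 - D x y / s` clamped to `[0, 1]`.
    set s := R ^ β / (2 * K) with hs
    have hs0 : 0 < s := by positivity
    have hr : 0 < (s / K) ^ β⁻¹ := by positivity
    obtain ⟨C, hC, hCle⟩ := exists_measure_qball_le_mul h1 hdoub hR (min_le_right _ _) hr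
    refine ⟨(s / K) ^ β⁻¹, R, K / s, C, hr, hR, min_le_left _ _, by positivity, hC, hCle, fun x =>
      ⟨fun y => max 0 (min 1 (2 - D x y / s)), ?_, fun y => ⟨le_max_left _ _, ?_⟩, fun y hy => ?_,
        fun y hy => ?_, fun y z => ?_⟩⟩
    · have : Measurable fun y => D x y := measurable_of_Iio fun t =>
        hX.measurableSet_qball_metric hK hβ (fun x y => (hD x y).1) htri x t
      fun_prop
    · exact max_le zero_le_one (min_le_left _ _)
    · have h2 : D x y < s :=
        exists_qball_subset_of_le_rpow hd hK hβ (fun x y => (hD x y).1) hs0 x hy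
      have h3 : D x y / s < 1 := (div_lt_one hs0).2 h2
      dsimp only
      rw [min_eq_left (by linarith), max_eq_right zero_le_one]
    · have h2 : R ≤ d x y := not_lt.1 hy
      have h3 : R ^ β ≤ K * D x y := (Real.rpow_le_rpow hR.le h2 hβ.le).trans (hD x y).2
      have h4 : 2 ≤ D x y / s := by
        rw [le_div_iff₀ hs0, hs]
        rw [show 2 * (R ^ β / (2 * K)) = R ^ β / K by field_simp, div_le_iff₀ hK]
        linarith
      exact max_eq_left ((min_le_right _ _).trans (by linarith))
    · refine (abs_clamp_sub_clamp_le _ _).trans ?_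
      rw [show 2 - D x y / s - (2 - D x z / s) = (D x z - D x y) / s by ring, abs_div,
        abs_of_pos hs0, div_mul_eq_mul_div]
      refine div_le_div_of_nonneg_right (le_trans ?_ (hD y z).1) hs0.le
      rw [abs_le]
      constructor
      · linarith [htri x z y, hsymm y z]
      · linarith [htri x y z]

end Bumps

/-! ### Mixed norms of geometrically decaying sequences -/

section EllNorm

theorem ellNorm_const_mul {q : ℝ≥0∞} (hq : 0 < q) (c : ℝ≥0∞) (a : ℤ → ℝ≥0∞) :
    ellNorm q (fun k => c * a k) = c * ellNorm q a := by
  unfold ellNorm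
  split_ifs with h
  · rw [ENNReal.mul_iSup]
  · have hq' : 0 < q.toReal := ENNReal.toReal_pos hq.ne' h
    simp only [ENNReal.mul_rpow_of_nonneg _ _ hq'.le]
    rw [ENNReal.tsum_mul_left, ENNReal.mul_rpow_of_nonneg _ _ (by positivity),
      ← ENNReal.rpow_mul, mul_one_div_cancel hq'.ne', ENNReal.rpow_one]

/-- `θ = 0` is allowed for `q = ∞`; this is the endpoint `α = ind(X, d)`. -/
theorem ellNorm_geometric_lt_top {q : ℝ≥0∞} (hq : 0 < q) {M θ : ℝ} (hM : 0 ≤ M) (hθ : 0 ≤ θ)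
    (h : q = ∞ ∨ 0 < θ) :
    ellNorm q (fun k => ENNReal.ofReal (M * (2 : ℝ) ^ (-θ * |(k : ℝ)|))) < ∞ := by
  have hle : ∀ k : ℤ, M * (2 : ℝ) ^ (-θ * |(k : ℝ)|) ≤ M := fun k => by
    refine mul_le_of_le_one_right hM (Real.rpow_le_one_of_one_le_of_nonpos one_le_two ?_)
    have := mul_nonneg hθ (abs_nonneg (k : ℝ))
    linarith
  unfold ellNorm
  split_ifs with hq'
  · exact (iSup_le fun k => ENNReal.ofReal_le_ofReal (hle k)).trans_lt ENNReal.ofReal_lt_top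
  · have hθ : 0 < θ := h.resolve_left hq'
    have hQ : 0 < q.toReal := ENNReal.toReal_pos hq.ne' hq'
    refine ENNReal.rpow_lt_top_of_nonneg (by positivity) ?_
    set x : ℝ := (2 : ℝ) ^ (-θ * q.toReal) with hx
    have hx0 : 0 ≤ x := by positivity
    have hx1 : x < 1 := Real.rpow_lt_one_of_one_lt_of_neg one_lt_two (by nlinarith)
    have hterm : ∀ k : ℤ, ENNReal.ofReal (M * (2 : ℝ) ^ (-θ * |(k : ℝ)|)) ^ q.toReal =
        ENNReal.ofReal (M ^ q.toReal * x ^ k.natAbs) := fun k => by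
      rw [ENNReal.ofReal_rpow_of_nonneg (by positivity) hQ.le, Real.mul_rpow hM (by positivity), hx,
        ← Real.rpow_natCast, ← Real.rpow_mul two_pos.le, ← Real.rpow_mul two_pos.le,
        Nat.cast_natAbs, Int.cast_abs]
      ring_nf
    have hgeo := (summable_geometric_of_lt_one hx0 hx1).mul_left (M ^ q.toReal)
    have hsum : Summable fun k : ℤ => M ^ q.toReal * x ^ k.natAbs :=
      Summable.of_nat_of_neg (by simpa using hgeo) (by simpa using hgeo)
    simp only [hterm]
    exact hsum.tsum_ofReal_ne_top

end EllNorm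

/-! ### Compactness forces total boundedness -/

section Converse

variable {X : Type*} [MeasurableSpace X] {d : X → X → ℝ} {μ : Measure X}

theorem eLpNorm_indicator_const_ennreal {p : ℝ≥0∞} (hp : 0 < p) (hp' : p < ∞) {B : Set X}
    (hB : MeasurableSet B) (c : ℝ≥0∞) :
    eLpNorm (B.indicator fun _ => c) p μ = c * μ B ^ p.toReal⁻¹ := by
  have hP : 0 < p.toReal := ENNReal.toReal_pos hp.ne' hp'.ne
  rw [eLpNorm_eq_lintegral_rpow_enorm_toReal hp.ne' hp'.ne, one_div]
  have h1 : ∀ x, ‖B.indicator (fun _ => c) x‖ₑ ^ p.toReal = B.indicator (fun _ => c ^ p.toReal) x :=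
    fun x => by by_cases hx : x ∈ B <;> simp [hx, hP]
  simp only [h1]
  rw [lintegral_indicator_const hB, ENNReal.mul_rpow_of_nonneg _ _ (inv_nonneg.2 hP.le),
    ENNReal.rpow_rpow_inv hP.ne']

/-- For a gradient that is a product of a function of `x` and a function of `k`, the mixed norm
factors. The order of the two norms is then irrelevant, so the Besov case has the same bound. -/
theorem homSeminormM_le_of_indicator {α : ℝ} {p q : ℝ≥0∞} (hp : 0 < p) (hp' : p < ∞) (hq : 0 < q)
    {u : X → ℝ} {B : Set X} (hB : MeasurableSet B) {c : ℝ≥0∞} {a : ℤ → ℝ≥0∞}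
    (hg : IsFracGradient d μ α u fun k => B.indicator fun _ => c * a k) :
    homSeminormM d μ α p q u ≤ c * ellNorm q a * μ B ^ p.toReal⁻¹ := by
  refine (iInf₂_le _ hg).trans (le_of_eq ?_)
  rw [← eLpNorm_indicator_const_ennreal hp hp' hB]
  congr 1
  ext x
  by_cases hx : x ∈ B
  · simp only [Set.indicator_of_mem hx, ellNorm_const_mul hq]
  · simpa only [Set.indicator_of_notMem hx, zero_mul] using ellNorm_const_mul hq 0 a

theorem homSeminormN_le_of_indicator {α : ℝ} {p q : ℝ≥0∞} (hp : 0 < p) (hp' : p < ∞) (hq : 0 < q)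
    {u : X → ℝ} {B : Set X} (hB : MeasurableSet B) {c : ℝ≥0∞} {a : ℤ → ℝ≥0∞}
    (hg : IsFracGradient d μ α u fun k => B.indicator fun _ => c * a k) :
    homSeminormN d μ α p q u ≤ c * ellNorm q a * μ B ^ p.toReal⁻¹ := by
  refine (iInf₂_le _ hg).trans (le_of_eq ?_)
  simp only [eLpNorm_indicator_const_ennreal hp hp' hB]
  rw [← ellNorm_const_mul hq, mul_comm, ← ellNorm_const_mul hq]
  congr 1
  ext k
  ring

/-- Decay of the natural fractional gradient of a bounded Hölder function. -/
theorem abs_le_rpow_mul_geometric {α β L t δ : ℝ} (hα : 0 < α) (hαβ : α ≤ β) (hL : 0 ≤ L)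
    (ht : t ≤ 1) (htL : t ≤ L * δ ^ β) {k : ℤ} (h1 : (2 : ℝ) ^ (-k - 1) ≤ δ)
    (h2 : δ < (2 : ℝ) ^ (-k)) :
    t ≤ δ ^ α * (max (2 ^ α) L * (2 : ℝ) ^ (-min α (β - α) * |(k : ℝ)|)) := by
  have hδ : 0 < δ := lt_of_lt_of_le (by positivity) h1
  have h1' : (2 : ℝ) ^ (-(k : ℝ) - 1) ≤ δ := by
    rw [← Real.rpow_intCast] at h1
    push_cast at h1
    exact h1
  have h2' : δ ≤ (2 : ℝ) ^ (-(k : ℝ)) := by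
    rw [← Real.rpow_intCast] at h2
    push_cast at h2
    exact h2.le
  set θ := min α (β - α)
  -- At large distances (`k ≤ 0`) the bound `t ≤ 1` suffices, the factor `2 ^ α` absorbing the `-1`
  -- in `h1`. At small distances the surplus Hölder exponent `β - α` gives the decay.
  rcases le_total (k : ℝ) 0 with hk | hk
  · refine ht.trans ?_
    calc (1 : ℝ) = ((2 : ℝ) ^ (-(k : ℝ) - 1)) ^ α * (2 ^ α * (2 : ℝ) ^ (-α * |(k : ℝ)|)) := by
          rw [← Real.rpow_mul two_pos.le, ← Real.rpow_add two_pos, ← Real.rpow_add two_pos,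
            abs_of_nonpos hk]
          ring_nf
          simp
      _ ≤ _ := by
          gcongr
          · exact le_max_left _ _
          · exact one_le_two
          · exact min_le_left _ _
  · refine htL.trans ?_
    calc L * δ ^ β = δ ^ α * (L * δ ^ (β - α)) := by
          rw [show β = α + (β - α) by ring, Real.rpow_add hδ]
          ring_nf
      _ ≤ δ ^ α * (L * ((2 : ℝ) ^ (-(k : ℝ))) ^ (β - α)) := by
          have : 0 ≤ β - α := by linarith
          gcongr
      _ = δ ^ α * (L * (2 : ℝ) ^ (-(β - α) * |(k : ℝ)|)) := by
          rw [← Real.rpow_mul two_pos.le, abs_of_nonneg hk]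
          ring_nf
      _ ≤ _ := by
          gcongr
          · exact le_max_right _ _
          · exact one_le_two
          · exact min_le_right _ _

/-- Consecutive terms of the convergent subsequence become close; `ENNReal.LpAddConst` replaces the
triangle inequality when `p < 1`. -/
theorem EmbedsCompactly.not_separated {S : Set (X → ℝ)} {N : (X → ℝ) → ℝ≥0∞} {p : ℝ≥0∞}
    (h : EmbedsCompactly S N p μ) {u : ℕ → X → ℝ} (hu : ∀ n, u n ∈ S) {C : ℝ≥0∞} (hC : C < ∞)
    (huC : ∀ n, N (u n) ≤ C) : ¬ ∀ m n, m ≠ n → 1 ≤ eLpNorm (u m - u n) p μ := by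
  intro hsep
  obtain ⟨f, φ, hf, hφ, hlim⟩ := h.2 u hu ⟨C, hC, huC⟩
  have hlim' := ENNReal.Tendsto.const_mul (a := ENNReal.LpAddConst p)
    (hlim.add ((tendsto_add_atTop_iff_nat 1).2 hlim)) (Or.inr (ENNReal.LpAddConst_lt_top p).ne)
  rw [add_zero, mul_zero] at hlim'
  obtain ⟨n, hn⟩ := (hlim'.eventually (gt_mem_nhds one_pos)).exists
  refine (hn.trans_le (hsep (φ n) (φ (n + 1)) (hφ (Nat.lt_succ_self n)).ne)).not_ge ?_
  have hm : ∀ n, AEStronglyMeasurable (u n - f) μ := fun n =>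
    (h.1 _ (hu n)).1.sub hf.1
  have := eLpNorm_sub_le' (hm (φ n)) (hm (φ (n + 1))) p
  rwa [sub_sub_sub_cancel_right] at this

/-- `S` and `T` stand for either scale of spaces. The only property of the semi-norm that is used is
its bound for gradients of product form, as the bumps have such gradients. -/
theorem isTotallyBounded_of_embedsCompactly [Nontrivial X] (hX : IsQuasiMetricMeasureSpace d μ)
    (hdoub : ∃ δ₀ : ℝ, 0 < δ₀ ∧ ∀ δ : ℝ, 0 < δ → δ ≤ δ₀ → IsDoublingAt d μ (optConst d) δ)
    {α : ℝ} (hα : 0 < α) {p q : ℝ≥0∞} (hp : 0 < p) (hp' : p < ∞) (hq : 0 < q)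
    (hadm : Admissible d α q) {S : Set (X → ℝ)} {T : (X → ℝ) → ℝ≥0∞}
    (hS : ∀ u, Measurable u → MemLp u p μ → T u < ∞ → u ∈ S)
    (hT : ∀ (u : X → ℝ) (B : Set X) (c : ℝ≥0∞) (a : ℤ → ℝ≥0∞), MeasurableSet B →
      IsFracGradient d μ α u (fun k => B.indicator fun _ => c * a k) →
        T u ≤ c * ellNorm q a * μ B ^ p.toReal⁻¹)
    (h : EmbedsCompactly S (fun u => eLpNorm u p μ + T u) p μ) : IsTotallyBounded d := by
  have hd := hX.isQuasiMetric
  have hP : 0 < p.toReal := ENNReal.toReal_pos hp.ne' hp'.ne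
  by_contra hnot
  obtain ⟨ε, hε, x, hx⟩ := exists_separated_seq_of_not_isTotallyBounded hnot
  obtain ⟨R₀, hR₀, hdisj⟩ := hd.exists_disjoint_balls hε hx
  obtain ⟨ρ, β, hρ, hdρ, hβC, hαβ, hqβ⟩ := hadm.exists_exponent hα
  obtain ⟨r, R, L, C, hr, hR, hRR₀, hL, hC, hCle, hbump⟩ :=
    hX.exists_bump hdoub hρ hdρ (hα.trans_le hαβ) hβC hR₀
  choose φ hφm hφ01 hφ1 hφ0 hφL using fun n => hbump (x n)
  set a : ℤ → ℝ≥0∞ := fun k =>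
    ENNReal.ofReal (max (2 ^ α) L * (2 : ℝ) ^ (-min α (β - α) * |(k : ℝ)|)) with ha
  have hafin : ellNorm q a < ∞ := ellNorm_geometric_lt_top hq (le_max_of_le_right hL)
    (le_min hα.le (sub_nonneg.2 hαβ)) (hqβ.imp id fun h => lt_min hα (sub_pos.2 h))
  have hrpos := fun n => hX.measure_qball_pos (x n) r hr
  have hrfin := fun n => hX.measure_qball_lt_top (x n) r hr
  have hRm := fun n => hX.measurableSet_qball (x n) R hR
  -- This normalises the bump to have `L^p` norm `1` on the inner ball; comparability of the two
  -- balls then bounds the full norm uniformly in `n`.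
  set b : ℕ → ℝ≥0∞ := fun n => (μ (qball d (x n) r) ^ p.toReal⁻¹)⁻¹ with hb
  have hbr : ∀ n, b n * μ (qball d (x n) r) ^ p.toReal⁻¹ = 1 := fun n =>
    ENNReal.inv_mul_cancel (ENNReal.rpow_pos (hrpos n) (hrfin n).ne).ne'
      (ENNReal.rpow_ne_top_of_nonneg (inv_nonneg.2 hP.le) (hrfin n).ne)
  have hbfin : ∀ n, b n ≠ ∞ := fun n =>
    ENNReal.inv_ne_top.2 (ENNReal.rpow_pos (hrpos n) (hrfin n).ne).ne'
  have hbR : ∀ n, b n * μ (qball d (x n) R) ^ p.toReal⁻¹ ≤ C ^ p.toReal⁻¹ := fun n => by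
    calc b n * μ (qball d (x n) R) ^ p.toReal⁻¹
        ≤ b n * (C * μ (qball d (x n) r)) ^ p.toReal⁻¹ := by
          gcongr
          exact hCle _
      _ = C ^ p.toReal⁻¹ * (b n * μ (qball d (x n) r) ^ p.toReal⁻¹) := by
          rw [ENNReal.mul_rpow_of_nonneg _ _ (inv_nonneg.2 hP.le)]
          ring
      _ = C ^ p.toReal⁻¹ := by rw [hbr, mul_one]
  have hCfin : C ^ p.toReal⁻¹ < ∞ := ENNReal.rpow_lt_top_of_nonneg (inv_nonneg.2 hP.le) hC.ne
  set u : ℕ → X → ℝ := fun n y => (b n).toReal * φ n y with hu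
  have hbe : ∀ n, ‖(b n).toReal‖ₑ = b n := fun n => by
    rw [Real.enorm_of_nonneg ENNReal.toReal_nonneg, ENNReal.ofReal_toReal (hbfin n)]
  have hum : ∀ n, Measurable (u n) := fun n => (hφm n).const_mul _
  have hunorm : ∀ n, eLpNorm (u n) p μ ≤ C ^ p.toReal⁻¹ := fun n => by
    refine le_trans ?_ (hbR n)
    rw [← eLpNorm_indicator_const_ennreal hp hp' (hRm n)]
    refine eLpNorm_mono_enorm fun y => ?_
    by_cases hy : y ∈ qball d (x n) R
    · rw [Set.indicator_of_mem hy, enorm_eq_self, hu, enorm_mul, hbe]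
      refine mul_le_of_le_one_right' ?_
      rw [Real.enorm_of_nonneg (hφ01 n y).1, ENNReal.ofReal_le_one]
      exact (hφ01 n y).2
    · simp [hu, hφ0 n y hy]
  -- The indicator may be inserted because the difference of values vanishes when both points lie
  -- off the support.
  have hgrad : ∀ n, IsFracGradient d μ α (u n)
      fun k => (qball d (x n) R).indicator fun _ => b n * a k := fun n => by
    refine ⟨fun k => measurable_const.indicator (hRm n), ∅, MeasurableSet.empty, by simp,
      fun k y z _ _ h1 h2 => ?_⟩
    rw [← Real.enorm_eq_ofReal_abs, hu]
    dsimp only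
    rw [← mul_sub, enorm_mul, hbe, Real.enorm_eq_ofReal_abs]
    have h3 : |φ n y - φ n z| ≤ 1 := by
      rw [abs_le]
      constructor <;> linarith [(hφ01 n y).1, (hφ01 n y).2, (hφ01 n z).1, (hφ01 n z).2]
    have h4 := abs_le_rpow_mul_geometric hα hαβ hL h3 (hφL n y z) h1 h2
    have h5 : ENNReal.ofReal |φ n y - φ n z| ≤ ENNReal.ofReal (d y z ^ α) * a k := by
      rw [ha, ← ENNReal.ofReal_mul (Real.rpow_nonneg (hd.nonneg y z) _)]
      exact ENNReal.ofReal_le_ofReal h4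
    have h6 : b n * ENNReal.ofReal |φ n y - φ n z| ≤ ENNReal.ofReal (d y z ^ α) * (b n * a k) := by
      refine (mul_le_mul_right h5 _).trans (le_of_eq (by ring))
    by_cases hy : y ∈ qball d (x n) R
    · refine h6.trans (mul_le_mul_right ?_ _)
      rw [Set.indicator_of_mem hy]
      exact le_self_add
    · by_cases hz : z ∈ qball d (x n) R
      · refine h6.trans (mul_le_mul_right ?_ _)
        rw [Set.indicator_of_mem hz]
        exact le_add_self
      · simp [hφ0 n y hy, hφ0 n z hz]
  have hTle : ∀ n, T (u n) ≤ ellNorm q a * C ^ p.toReal⁻¹ := fun n => by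
    refine (hT _ _ _ _ (hRm n) (hgrad n)).trans ?_
    rw [mul_comm (b n), mul_assoc]
    exact mul_le_mul_right (hbR n) _
  have hTfin : ellNorm q a * C ^ p.toReal⁻¹ < ∞ := ENNReal.mul_lt_top hafin hCfin
  refine h.not_separated (u := u) (fun n => hS _ (hum n)
      ⟨(hum n).aestronglyMeasurable, (hunorm n).trans_lt hCfin⟩ ((hTle n).trans_lt hTfin))
    (ENNReal.add_lt_top.2 ⟨hCfin, hTfin⟩) (fun n => add_le_add (hunorm n) (hTle n))
    fun m n hmn => ?_
  rw [← hbr m, ← eLpNorm_indicator_const_ennreal hp hp' (hX.measurableSet_qball (x m) r hr)]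
  refine eLpNorm_mono_enorm fun y => ?_
  by_cases hy : y ∈ qball d (x m) r
  -- The inner ball lies in the outer one because the bump equals `1` on the former and `0` off the
  -- latter.
  · have hym : y ∈ qball d (x m) R := by
      by_contra hcon
      have := hφ0 m y hcon
      rw [hφ1 m y hy] at this
      exact one_ne_zero this
    have hyn : y ∉ qball d (x n) R := Set.disjoint_left.1 (hdisj R hRR₀ hmn) hym
    rw [Set.indicator_of_mem hy, enorm_eq_self, Pi.sub_apply, hu]
    dsimp only
    rw [hφ1 m y hy, hφ0 n y hyn, mul_one, mul_zero, sub_zero, hbe]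
  · simp [hy]

end Converse

end QuasiMetric

/-! ### The equivalence -/

theorem mainTheorem1 {X : Type*} [Nontrivial X] [MeasurableSpace X]
    (d : X → X → ℝ) (μ : Measure X)
    (hX : QuasiMetric.IsQuasiMetricMeasureSpace d μ)
    (hdoub : ∃ δ₀ : ℝ, 0 < δ₀ ∧ ∀ δ : ℝ, 0 < δ → δ ≤ δ₀ →
      QuasiMetric.IsDoublingAt d μ (QuasiMetric.optConst d) δ) :
    List.TFAE [
      QuasiMetric.IsTotallyBounded d,
      QuasiMetric.IsIntegrableMeasure d μ,
      ∀ (α : ℝ) (p q : ℝ≥0∞), 0 < α → 0 < p → p < ∞ → 0 < q →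
        QuasiMetric.Admissible d α q → QuasiMetric.CompactEmbM d μ α p q,
      ∀ (α : ℝ) (p q : ℝ≥0∞), 0 < α → 0 < p → p < ∞ → 0 < q →
        QuasiMetric.Admissible d α q → QuasiMetric.CompactEmbN d μ α p q,
      ∃ (α : ℝ) (p q : ℝ≥0∞), 0 < α ∧ 0 < p ∧ p < ∞ ∧ 0 < q ∧
        QuasiMetric.Admissible d α q ∧ QuasiMetric.CompactEmbM d μ α p q,
      ∃ (α : ℝ) (p q : ℝ≥0∞), 0 < α ∧ 0 < p ∧ p < ∞ ∧ 0 < q ∧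
        QuasiMetric.Admissible d α q ∧ QuasiMetric.CompactEmbN d μ α p q] := by
  -- An admissible exponent for `q = 1` is needed to pass from the universal statements to the
  -- existential ones.
  obtain ⟨α₀, hα₀, hadm₀⟩ := hX.isQuasiMetric.exists_admissible 1
  tfae_have 1 → 2 := QuasiMetric.isIntegrableMeasure_of_isTotallyBounded hX
  tfae_have 2 → 1 := QuasiMetric.isTotallyBounded_of_isIntegrableMeasure hX hdoub
  tfae_have 1 → 3 := fun h α p q hα hp hp' hq _ =>
    QuasiMetric.compactEmbM_of_isTotallyBounded hX h hα hp hp' hq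
  tfae_have 1 → 4 := fun h α p q hα hp hp' hq _ =>
    QuasiMetric.compactEmbN_of_isTotallyBounded hX h hα hp hp' hq
  tfae_have 3 → 5 := fun h => ⟨α₀, 1, 1, hα₀, one_pos, ENNReal.one_lt_top, one_pos, hadm₀,
    h α₀ 1 1 hα₀ one_pos ENNReal.one_lt_top one_pos hadm₀⟩
  tfae_have 4 → 6 := fun h => ⟨α₀, 1, 1, hα₀, one_pos, ENNReal.one_lt_top, one_pos, hadm₀,
    h α₀ 1 1 hα₀ one_pos ENNReal.one_lt_top one_pos hadm₀⟩
  tfae_have 5 → 1 := fun ⟨α, p, q, hα, hp, hp', hq, hadm, h⟩ =>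
    QuasiMetric.isTotallyBounded_of_embedsCompactly hX hdoub hα hp hp' hq hadm
      (S := QuasiMetric.spaceM d μ α p q) (T := QuasiMetric.homSeminormM d μ α p q)
      (fun _ hu hup huT => ⟨hu, hup, huT⟩)
      (fun _ _ _ _ hB hg => QuasiMetric.homSeminormM_le_of_indicator hp hp' hq hB hg) h
  tfae_have 6 → 1 := fun ⟨α, p, q, hα, hp, hp', hq, hadm, h⟩ =>
    QuasiMetric.isTotallyBounded_of_embedsCompactly hX hdoub hα hp hp' hq hadm
      (S := QuasiMetric.spaceN d μ α p q) (T := QuasiMetric.homSeminormN d μ α p q)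
      (fun _ hu hup huT => ⟨hu, hup, huT⟩)
      (fun _ _ _ _ hB hg => QuasiMetric.homSeminormN_le_of_indicator hp hp' hq hB hg) h
  tfae_finish
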